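/- Let $K$ be an algebraically closed field of characteristic $0$ and $G$ a finite group. A glider (of length at most one) of $G$ is a pair of subspaces $M_{-1}\subseteq M_0$ of a $K[G]$-module $\Omega$ with $\dim_K M_0<\infty$ and $K[G]M_{-1}\subseteq M_0$. A morphism is a linear map $f\colon M_0\to N_0$ with $f(M_{-1})\subseteq N_{-1}$ and $f(gm)=gf(m)$ for $g\in G$, $m\in M_{-1}$. Direct sums and tensor products are taken degreewise. Let $K^{\oplus}$ be the split Grothendieck ring of gliders modulo the ideal generated by the gliders of length zero ($M_{-1}=0$). A glider with $M_{-1}\ne 0$ is irreducible if every proper subglider $N_{-1}\subseteq N_0$ has $N_{-1}=0$. Equivalently, $\dim M_{-1}=1$ and $M_0=K[G]M_{-1}$. Let $\overline R_1(\widetilde G)\subseteq K^{\oplus}$ be the subring generated by the classes of irreducible gliders and put $\mathbb Q(\widetilde G)=\mathbb Q\otimes_{\mathbb Z}\overline R_1(\widetilde G)$. Write $M_{(A,B)}$ for the irreducible glider, and for its class in $\mathbb Q(\widetilde G)$, with the following parameters: $A$ is the set of one-dimensional representations occurring in $M_0$; $B$ assigns to every irreducible representation $U$ of dimension at least two the subspace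 of $U$ formed by the images of $M_{-1}$ under the $K[G]$-homomorphisms $M_0\to U$. Here $B=\emptyset$ means that all these subspaces are zero. Write $T_G$ for the trivial representation of $G$, fix an isomorphism $z\mapsto T_z$ from $G^{ab}$ to the group of one-dimensional representations of $G$, and write $\mathbb Q[G^{ab}]\subseteq\mathbb Q(\widetilde G)$ for the image of the group algebra under $z\mapsto M_{(\{T_z\},\emptyset)}=[K\subseteq T_z]$. The obstruction module $R=R(G)$ is the $\mathbb Q$-subspace of $\mathbb Q(\widetilde G)$ spanned by the classes of all irreducible gliders $M_{(A,B)}$ some power $M_{(A,B)}^{\,n}$ ($n\ge 1$) of which is an idempotent of the form $M_{(\{T_G\},D)}$. For a subgroup $H\le G$, let $\operatorname{Ind}_H^G(M_{T_H})$ be the glider $K(1\otimes 1)\subseteq K[G]\otimes_{K[H]}T_H$ induced from $M_{T_H}=(K\subseteq T_H)$, where $T_H$ is the trivial representation of $H$. **Theorem.** The group $G$ is nilpotent if and only if $R=\mathbb Q[G^{ab}]$. Moreover, if $G$ is non-nilpotent and $H$ is a non-normal maximal subgroup of $G$, then $\operatorname{Ind}_H^G(M_{T_H})=M_{(\{T_G\},D)}$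 for some $D$, and its class lies in $R\setminus\mathbb Q[G^{ab}]$. -/

import Mathlib

open scoped TensorProduct

universe u v

/-- A (Noetherian) glider of essential length at most one for the one-step algebra filtration
`K ⊆ K[G]` (the filtration attached to the chain of groups `1 ≤ G`): a `K[G]`-module `Ω` and
subspaces `M₁ ⊆ M₀ ⊆ Ω` (the members of the chain in degrees `-1` and `0`), with `M₀`
finite-dimensional and `K[G] M₁ ⊆ M₀`. The members in degrees `≤ -2` are zero. -/
structure Glider (K : Type u) (G : Type v) [Field K] [Group G] where
  Ω : Type (max u v)
  [instAddCommGroup : AddCommGroup Ω]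
  [instModule : Module K Ω]
  ρ : Representation K G Ω
  M₀ : Submodule K Ω
  M₁ : Submodule K Ω
  le : M₁ ≤ M₀
  smul_mem : ∀ (g : G), ∀ m ∈ M₁, ρ g m ∈ M₀
  finite : Module.Finite K M₀

attribute [instance] Glider.instAddCommGroup Glider.instModule Glider.finite

namespace Glider

noncomputable section

variable {K : Type u} {G : Type v} [Field K] [Group G]

/-- A linear map `f : M₀ → N₀` is a morphism of gliders if `f(M₁) ⊆ N₁` and `f(g m) = g f(m)` for
`g ∈ G` and `m ∈ M₁` (the overlying modules `Ω` play no role in morphisms). -/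
def IsHom (M N : Glider K G) (f : M.M₀ →ₗ[K] N.M₀) : Prop :=
  (∀ (m : M.Ω) (hm : m ∈ M.M₁), (f ⟨m, M.le hm⟩ : N.Ω) ∈ N.M₁) ∧
  (∀ (g : G) (m : M.Ω) (hm : m ∈ M.M₁),
    (f ⟨M.ρ g m, M.smul_mem g m hm⟩ : N.Ω) = N.ρ g (f ⟨m, M.le hm⟩ : N.Ω))

/-- Isomorphism of gliders: a morphism with an inverse morphism. -/
def Isomorphic (M N : Glider K G) : Prop :=
  ∃ e : M.M₀ ≃ₗ[K] N.M₀, IsHom M N e.toLinearMap ∧ IsHom N M e.symm.toLinearMap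

theorem Isomorphic.refl (M : Glider K G) : Isomorphic M M :=
  ⟨LinearEquiv.refl K M.M₀, ⟨fun _ hm => hm, fun _ _ _ => rfl⟩,
    ⟨fun _ hm => hm, fun _ _ _ => rfl⟩⟩

theorem Isomorphic.symm {M N : Glider K G} : Isomorphic M N → Isomorphic N M
  | ⟨e, h₁, h₂⟩ => ⟨e.symm, h₂, h₁⟩

theorem IsHom.comp {M N P : Glider K G} {f : M.M₀ →ₗ[K] N.M₀} {f' : N.M₀ →ₗ[K] P.M₀}
    (h : IsHom M N f) (h' : IsHom N P f') : IsHom M P (f' ∘ₗ f) := by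
  refine ⟨fun m hm => h'.1 _ (h.1 m hm), fun g m hm => ?_⟩
  have key := h'.2 g _ (h.1 m hm)
  simp only [LinearMap.comp_apply]
  rw [← key]
  congr 2
  exact Subtype.ext (h.2 g m hm)

theorem Isomorphic.trans {M N P : Glider K G} :
    Isomorphic M N → Isomorphic N P → Isomorphic M P
  | ⟨e, h₁, h₂⟩, ⟨e', h₁', h₂'⟩ => ⟨e.trans e', h₁.comp h₁', h₂'.comp h₂⟩

/-- An equivariant linear isomorphism of overlying modules matching the two members of the chains
gives an isomorphism of gliders. -/
theorem Isomorphic.ofEquiv {M N : Glider K G} (e : M.Ω ≃ₗ[K] N.Ω)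
    (he : ∀ g x, e (M.ρ g x) = N.ρ g (e x))
    (h₀ : ∀ x ∈ M.M₀, e x ∈ N.M₀) (h₀' : ∀ x ∈ N.M₀, e.symm x ∈ M.M₀)
    (h₁ : ∀ x ∈ M.M₁, e x ∈ N.M₁) (h₁' : ∀ x ∈ N.M₁, e.symm x ∈ M.M₁) : Isomorphic M N := by
  have he' : ∀ g x, e.symm (N.ρ g x) = M.ρ g (e.symm x) := fun g x => by
    rw [LinearEquiv.symm_apply_eq, he, LinearEquiv.apply_symm_apply]
  refine ⟨LinearEquiv.ofSubmodules e M.M₀ N.M₀ (le_antisymm ?_ ?_), ⟨?_, ?_⟩, ⟨?_, ?_⟩⟩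
  · rintro _ ⟨x, hx, rfl⟩
    exact h₀ x hx
  · intro y hy
    exact ⟨e.symm y, h₀' y hy, e.apply_symm_apply y⟩
  · exact fun m hm => h₁ m hm
  · exact fun g m _ => he g m
  · exact fun m hm => h₁' m hm
  · exact fun g m _ => he' g m

/-! ### Direct sums and tensor products -/

/-- Direct sum of gliders, degreewise. -/
abbrev directSum (M N : Glider K G) : Glider K G where
  Ω := M.Ω × N.Ω
  ρ := M.ρ.prod N.ρ
  M₀ := M.M₀.prod N.M₀
  M₁ := M.M₁.prod N.M₁
  le := Submodule.prod_mono M.le N.le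
  smul_mem g _ hm := ⟨M.smul_mem g _ hm.1, N.smul_mem g _ hm.2⟩
  finite := Module.Finite.of_fg
    ((Module.Finite.iff_fg.1 M.finite).prod (Module.Finite.iff_fg.1 N.finite))

/-- The subspace `A ⊗ B` of `V ⊗ W`, for subspaces `A` of `V` and `B` of `W`. -/
def tens {V W : Type*} [AddCommGroup V] [Module K V] [AddCommGroup W] [Module K W]
    (A : Submodule K V) (B : Submodule K W) : Submodule K (V ⊗[K] W) :=
  Submodule.span K {x | ∃ a ∈ A, ∃ b ∈ B, a ⊗ₜ[K] b = x}

section tens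

variable {V W : Type*} [AddCommGroup V] [Module K V] [AddCommGroup W] [Module K W]

theorem tmul_mem_tens {A : Submodule K V} {B : Submodule K W} {a : V} {b : W}
    (ha : a ∈ A) (hb : b ∈ B) : a ⊗ₜ[K] b ∈ tens A B :=
  Submodule.subset_span ⟨a, ha, b, hb, rfl⟩

theorem tens_le {A : Submodule K V} {B : Submodule K W} {C : Submodule K (V ⊗[K] W)} :
    tens A B ≤ C ↔ ∀ a ∈ A, ∀ b ∈ B, a ⊗ₜ[K] b ∈ C := by
  rw [tens, Submodule.span_le]
  constructor
  · exact fun h a ha b hb => h ⟨a, ha, b, hb, rfl⟩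
  · rintro h _ ⟨a, ha, b, hb, rfl⟩
    exact h a ha b hb

theorem tens_eq_range (A : Submodule K V) (B : Submodule K W) :
    tens A B = LinearMap.range (TensorProduct.mapIncl A B) := by
  rw [TensorProduct.range_mapIncl]
  apply le_antisymm
  · exact tens_le.2 fun a ha b hb => Submodule.apply_mem_map₂ _ ha hb
  · exact Submodule.map₂_le.2 fun a ha b hb => tmul_mem_tens ha hb

/-- `tens A B` is the tensor product of `A` and `B`. -/
def tensEquiv (A : Submodule K V) (B : Submodule K W) : (A ⊗[K] B) ≃ₗ[K] tens A B :=
  (LinearEquiv.ofInjective (TensorProduct.mapIncl A B)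
    (Module.Flat.tensorProduct_mapIncl_injective_of_right A B)).trans
    (LinearEquiv.ofEq _ _ (tens_eq_range A B).symm)

theorem tensEquiv_tmul {A : Submodule K V} {B : Submodule K W} (a : A) (b : B) :
    tensEquiv A B (a ⊗ₜ b) = ⟨(a : V) ⊗ₜ[K] (b : W), tmul_mem_tens a.2 b.2⟩ := rfl

theorem tensEquiv_symm_tmul {A : Submodule K V} {B : Submodule K W} {a : V} {b : W}
    (ha : a ∈ A) (hb : b ∈ B) :
    (tensEquiv A B).symm ⟨a ⊗ₜ[K] b, tmul_mem_tens ha hb⟩ =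
      (⟨a, ha⟩ : A) ⊗ₜ[K] (⟨b, hb⟩ : B) := by
  rw [LinearEquiv.symm_apply_eq]
  rfl

end tens

/-- Tensor product of gliders, degreewise, with the diagonal action of `G` on `Ω ⊗ Ω'`. -/
abbrev tensor (M N : Glider K G) : Glider K G where
  Ω := M.Ω ⊗[K] N.Ω
  ρ := M.ρ.tprod N.ρ
  M₀ := tens M.M₀ N.M₀
  M₁ := tens M.M₁ N.M₁
  le := tens_le.2 fun _ ha _ hb => tmul_mem_tens (M.le ha) (N.le hb)
  smul_mem g m hm := by
    have : tens M.M₁ N.M₁ ≤ (tens M.M₀ N.M₀).comap ((M.ρ.tprod N.ρ) g) :=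
      tens_le.2 fun a ha b hb => tmul_mem_tens (M.smul_mem g a ha) (N.smul_mem g b hb)
    exact this hm
  finite := Module.Finite.equiv (tensEquiv M.M₀ N.M₀)

/-- The glider `(K ⊆ T_χ)` for a one-dimensional representation `T_χ`, i.e. a linear character
`χ : G → Kˣ`. -/
abbrev linear (χ : G →* Kˣ) : Glider K G where
  Ω := ULift.{v} K
  ρ := (algebraMap K (Module.End K (ULift.{v} K)) : K →* Module.End K (ULift.{v} K)).comp
    ((Units.coeHom K).comp χ)
  M₀ := ⊤
  M₁ := ⊤
  le := le_rfl
  smul_mem _ _ _ := Submodule.mem_top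
  finite := inferInstance

theorem IsHom.of_span {M P : Glider K G} (f : M.M₀ →ₗ[K] P.M₀) (S : Set M.Ω)
    (hS : M.M₁ = Submodule.span K S)
    (h₁ : ∀ m ∈ S, ∀ (hm : m ∈ M.M₁), (f ⟨m, M.le hm⟩ : P.Ω) ∈ P.M₁)
    (h₂ : ∀ g, ∀ m ∈ S, ∀ (hm : m ∈ M.M₁),
      (f ⟨M.ρ g m, M.smul_mem g m hm⟩ : P.Ω) = P.ρ g (f ⟨m, M.le hm⟩ : P.Ω)) :
    IsHom M P f := by
  let T : Submodule K M.M₁ := P.M₁.comap (P.M₀.subtype ∘ₗ f ∘ₗ Submodule.inclusion M.le)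
  let E : G → Submodule K M.M₁ := fun g => LinearMap.eqLocus
    (P.M₀.subtype ∘ₗ f ∘ₗ (M.ρ g).restrict (p := M.M₁) (q := M.M₀) (M.smul_mem g))
    (P.ρ g ∘ₗ P.M₀.subtype ∘ₗ f ∘ₗ Submodule.inclusion M.le)
  have key : ∀ F : Submodule K M.M₁, (∀ m ∈ S, ∀ hm : m ∈ M.M₁, (⟨m, hm⟩ : M.M₁) ∈ F) →
      ∀ m (hm : m ∈ M.M₁), (⟨m, hm⟩ : M.M₁) ∈ F := by
    intro F hF m hm
    have : M.M₁ ≤ F.map M.M₁.subtype := by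
      conv_lhs => rw [hS]
      refine Submodule.span_le.2 fun x hx => ?_
      have hx' : x ∈ M.M₁ := hS ▸ Submodule.subset_span hx
      exact ⟨⟨x, hx'⟩, hF x hx hx', rfl⟩
    obtain ⟨y, hy, rfl⟩ := this hm
    exact hy
  exact ⟨key T h₁, fun g => key (E g) (h₂ g)⟩

theorem isHom_tensor {M N P : Glider K G} (f : (tensor M N).M₀ →ₗ[K] P.M₀)
    (h₁ : ∀ m (hm : m ∈ M.M₁) n (hn : n ∈ N.M₁),
      (f ⟨m ⊗ₜ n, tmul_mem_tens (M.le hm) (N.le hn)⟩ : P.Ω) ∈ P.M₁)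
    (h₂ : ∀ g m (hm : m ∈ M.M₁) n (hn : n ∈ N.M₁),
      (f ⟨M.ρ g m ⊗ₜ N.ρ g n, tmul_mem_tens (M.smul_mem g m hm) (N.smul_mem g n hn)⟩ : P.Ω) =
        P.ρ g (f ⟨m ⊗ₜ n, tmul_mem_tens (M.le hm) (N.le hn)⟩ : P.Ω)) :
    IsHom (tensor M N) P f := by
  refine IsHom.of_span f _ rfl ?_ ?_
  · rintro _ ⟨a, ha, b, hb, rfl⟩ _
    exact h₁ a ha b hb
  · rintro g _ ⟨a, ha, b, hb, rfl⟩ _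
    exact h₂ g a ha b hb

theorem Isomorphic.tensor {M M' N N' : Glider K G} :
    Isomorphic M M' → Isomorphic N N' → Isomorphic (tensor M N) (tensor M' N') := by
  rintro ⟨e, he, he'⟩ ⟨d, hd, hd'⟩
  refine ⟨((tensEquiv M.M₀ N.M₀).symm.trans (TensorProduct.congr e d)).trans
    (tensEquiv M'.M₀ N'.M₀), isHom_tensor _ ?_ ?_, isHom_tensor _ ?_ ?_⟩
  · intro m hm n hn
    simp only [LinearEquiv.coe_coe, LinearEquiv.trans_apply,
      tensEquiv_symm_tmul (M.le hm) (N.le hn), TensorProduct.congr_tmul, tensEquiv_tmul]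
    exact tmul_mem_tens (he.1 m hm) (hd.1 n hn)
  · intro g m hm n hn
    simp only [LinearEquiv.coe_coe, LinearEquiv.trans_apply,
      tensEquiv_symm_tmul (M.le hm) (N.le hn),
      tensEquiv_symm_tmul (M.smul_mem g m hm) (N.smul_mem g n hn),
      TensorProduct.congr_tmul, tensEquiv_tmul]
    exact congrArg₂ (TensorProduct.mk K M'.Ω N'.Ω · ·) (he.2 g m hm) (hd.2 g n hn)
  · intro m hm n hn
    simp only [LinearEquiv.coe_coe, LinearEquiv.trans_symm, LinearEquiv.trans_apply,
      tensEquiv_symm_tmul (M'.le hm) (N'.le hn), TensorProduct.congr_symm_tmul,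
      LinearEquiv.symm_symm, tensEquiv_tmul]
    exact tmul_mem_tens (he'.1 m hm) (hd'.1 n hn)
  · intro g m hm n hn
    simp only [LinearEquiv.coe_coe, LinearEquiv.trans_symm, LinearEquiv.trans_apply,
      tensEquiv_symm_tmul (M'.le hm) (N'.le hn),
      tensEquiv_symm_tmul (M'.smul_mem g m hm) (N'.smul_mem g n hn),
      TensorProduct.congr_symm_tmul, LinearEquiv.symm_symm, tensEquiv_tmul]
    exact congrArg₂ (TensorProduct.mk K M.Ω N.Ω · ·) (he'.2 g m hm) (hd'.2 g n hn)

theorem Isomorphic.directSum {M M' N N' : Glider K G} :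
    Isomorphic M M' → Isomorphic N N' → Isomorphic (directSum M N) (directSum M' N') := by
  rintro ⟨e, he, he'⟩ ⟨d, hd, hd'⟩
  refine ⟨
    { toFun := fun x => ⟨(e ⟨x.1.1, x.2.1⟩, d ⟨x.1.2, x.2.2⟩), (e _).2, (d _).2⟩
      invFun := fun x =>
        ⟨(e.symm ⟨x.1.1, x.2.1⟩, d.symm ⟨x.1.2, x.2.2⟩), (e.symm _).2, (d.symm _).2⟩
      map_add' := fun x y => Subtype.ext (Prod.ext
        (congrArg Subtype.val (map_add e ⟨x.1.1, x.2.1⟩ ⟨y.1.1, y.2.1⟩))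
        (congrArg Subtype.val (map_add d ⟨x.1.2, x.2.2⟩ ⟨y.1.2, y.2.2⟩)))
      map_smul' := fun c x => Subtype.ext (Prod.ext
        (congrArg Subtype.val (map_smul e c ⟨x.1.1, x.2.1⟩))
        (congrArg Subtype.val (map_smul d c ⟨x.1.2, x.2.2⟩)))
      left_inv := fun x => by simp
      right_inv := fun x => by simp }, ⟨?_, ?_⟩, ⟨?_, ?_⟩⟩
  · exact fun m hm => ⟨he.1 _ hm.1, hd.1 _ hm.2⟩
  · exact fun g m hm => Prod.ext (he.2 g _ hm.1) (hd.2 g _ hm.2)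
  · exact fun m hm => ⟨he'.1 _ hm.1, hd'.1 _ hm.2⟩
  · exact fun g m hm => Prod.ext (he'.2 g _ hm.1) (hd'.2 g _ hm.2)

theorem tensor_comm (M N : Glider K G) : Isomorphic (tensor M N) (tensor N M) := by
  have key : ∀ {V W : Type (max u v)} [AddCommGroup V] [Module K V] [AddCommGroup W] [Module K W]
      (A : Submodule K V) (B : Submodule K W), ∀ x ∈ tens A B,
      TensorProduct.comm K V W x ∈ tens B A := by
    intro V W _ _ _ _ A B x hx
    have : tens A B ≤ (tens B A).comap (TensorProduct.comm K V W).toLinearMap :=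
      tens_le.2 fun a ha b hb => tmul_mem_tens hb ha
    exact this hx
  refine Isomorphic.ofEquiv (TensorProduct.comm K M.Ω N.Ω) ?_ (key _ _) (key _ _) (key _ _)
    (key _ _)
  intro g x
  change _ = TensorProduct.map (N.ρ g) (M.ρ g) _
  change TensorProduct.comm K M.Ω N.Ω (TensorProduct.map (M.ρ g) (N.ρ g) x) = _
  induction x using TensorProduct.induction_on with
  | zero => simp
  | tmul a b => rfl
  | add a b ha hb => simp only [map_add, ha, hb]

theorem tensor_assoc (M N P : Glider K G) :
    Isomorphic (tensor (tensor M N) P) (tensor M (tensor N P)) := by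
  have key : ∀ (A : Submodule K M.Ω) (B : Submodule K N.Ω) (C : Submodule K P.Ω),
      ∀ x ∈ tens (tens A B) C, TensorProduct.assoc K M.Ω N.Ω P.Ω x ∈ tens A (tens B C) := by
    intro A B C x hx
    have : tens (tens A B) C ≤
        (tens A (tens B C)).comap (TensorProduct.assoc K M.Ω N.Ω P.Ω).toLinearMap := by
      refine tens_le.2 fun x hx c hc => ?_
      have h : tens A B ≤ ((tens A (tens B C)).comap
          (TensorProduct.assoc K M.Ω N.Ω P.Ω).toLinearMap).comap
          ((TensorProduct.mk K (M.Ω ⊗[K] N.Ω) P.Ω).flip c) :=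
        tens_le.2 fun a ha b hb => tmul_mem_tens ha (tmul_mem_tens hb hc)
      exact h hx
    exact this hx
  have key' : ∀ (A : Submodule K M.Ω) (B : Submodule K N.Ω) (C : Submodule K P.Ω),
      ∀ x ∈ tens A (tens B C), (TensorProduct.assoc K M.Ω N.Ω P.Ω).symm x ∈
        tens (tens A B) C := by
    intro A B C x hx
    have : tens A (tens B C) ≤
        (tens (tens A B) C).comap (TensorProduct.assoc K M.Ω N.Ω P.Ω).symm.toLinearMap := by
      refine tens_le.2 fun a ha x hx => ?_
      have h : tens B C ≤ ((tens (tens A B) C).comap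
          (TensorProduct.assoc K M.Ω N.Ω P.Ω).symm.toLinearMap).comap
          (TensorProduct.mk K M.Ω (N.Ω ⊗[K] P.Ω) a) :=
        tens_le.2 fun b hb c hc => tmul_mem_tens (tmul_mem_tens ha hb) hc
      exact h hx
    exact this hx
  refine Isomorphic.ofEquiv (TensorProduct.assoc K M.Ω N.Ω P.Ω) ?_ (key _ _ _) (key' _ _ _)
    (key _ _ _) (key' _ _ _)
  intro g x
  have : (TensorProduct.assoc K M.Ω N.Ω P.Ω).toLinearMap ∘ₗ
      TensorProduct.map (TensorProduct.map (M.ρ g) (N.ρ g)) (P.ρ g) =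
      TensorProduct.map (M.ρ g) (TensorProduct.map (N.ρ g) (P.ρ g)) ∘ₗ
        (TensorProduct.assoc K M.Ω N.Ω P.Ω).toLinearMap :=
    TensorProduct.ext_threefold fun a b c => rfl
  exact LinearMap.congr_fun this x

variable (K) in
/-- `ULift K` is `K`. -/
def down : ULift.{v} K ≃ₗ[K] K := ULift.moduleEquiv

theorem linear_ρ (χ : G →* Kˣ) (g : G) (x : ULift.{v} K) :
    (linear χ).ρ g x = ((χ g : Kˣ) : K) • x := rfl

theorem linear_tensor (χ ψ : G →* Kˣ) :
    Isomorphic (linear (χ * ψ)) (tensor (linear χ) (linear ψ)) := by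
  have hmem : ∀ x, x ∈ tens (⊤ : Submodule K (ULift.{v} K)) (⊤ : Submodule K (ULift.{v} K)) := by
    intro x
    induction x using TensorProduct.induction_on with
    | zero => exact Submodule.zero_mem _
    | tmul a b => exact tmul_mem_tens Submodule.mem_top Submodule.mem_top
    | add a b ha hb => exact Submodule.add_mem _ ha hb
  let d : ULift.{v} K ≃ₗ[K] K := down K
  obtain ⟨e, he⟩ : ∃ e : ULift.{v} K ≃ₗ[K] (ULift.{v} K ⊗[K] ULift.{v} K),
      ∀ x, e x = (d.symm 1) ⊗ₜ[K] x :=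
    ⟨d.trans ((TensorProduct.lid K K).symm.trans (TensorProduct.congr d.symm d.symm)),
      fun x => by simp⟩
  refine Isomorphic.ofEquiv (M := linear (χ * ψ)) (N := tensor (linear χ) (linear ψ)) e
    (fun g x => ?_) (fun x _ => hmem (e x)) (fun _ _ => Submodule.mem_top)
    (fun x _ => hmem (e x)) (fun _ _ => Submodule.mem_top)
  rw [linear_ρ, he, he, Representation.tprod_apply, TensorProduct.map_tmul, linear_ρ, linear_ρ,
    MonoidHom.mul_apply, Units.val_mul, TensorProduct.smul_tmul, smul_smul]

theorem one_tensor (M : Glider K G) : Isomorphic (tensor (linear 1) M) M := by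
  let d : ULift.{v} K ≃ₗ[K] K := down K
  obtain ⟨e, e_tmul, e_symm⟩ : ∃ e : (ULift.{v} K ⊗[K] M.Ω) ≃ₗ[K] M.Ω,
      (∀ c m, e (c ⊗ₜ m) = d c • m) ∧ (∀ m, e.symm m = d.symm 1 ⊗ₜ[K] m) :=
    ⟨(TensorProduct.congr d (LinearEquiv.refl K M.Ω)).trans (TensorProduct.lid K M.Ω),
      fun c m => by simp, fun m => by simp⟩
  have key : ∀ A : Submodule K M.Ω, ∀ x ∈ tens (⊤ : Submodule K (ULift.{v} K)) A, e x ∈ A := by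
    intro A x hx
    have : tens (⊤ : Submodule K (ULift.{v} K)) A ≤ A.comap e.toLinearMap :=
      tens_le.2 fun c _ m hm => by
        change e (c ⊗ₜ m) ∈ A
        rw [e_tmul]
        exact A.smul_mem _ hm
    exact this hx
  have key' : ∀ A : Submodule K M.Ω, ∀ x ∈ A,
      e.symm x ∈ tens (⊤ : Submodule K (ULift.{v} K)) A := by
    intro A x hx
    rw [e_symm]
    exact tmul_mem_tens Submodule.mem_top hx
  refine Isomorphic.ofEquiv (M := tensor (linear 1) M) e (fun g x => ?_)
    (key _) (key' _) (key _) (key' _)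
  rw [Representation.tprod_apply]
  induction x using TensorProduct.induction_on with
  | zero => simp only [map_zero]
  | tmul a b =>
    rw [TensorProduct.map_tmul, e_tmul, e_tmul, map_smul, linear_ρ, MonoidHom.one_apply,
      Units.val_one, one_smul]
  | add a b ha hb => simp only [map_add, ha, hb]

theorem tensor_directSum (M N P : Glider K G) :
    Isomorphic (tensor M (directSum N P)) (directSum (tensor M N) (tensor M P)) := by
  let e := TensorProduct.prodRight K K M.Ω N.Ω P.Ω
  have e_tmul : ∀ (m : M.Ω) (n : N.Ω) (p : P.Ω), e (m ⊗ₜ (n, p)) = (m ⊗ₜ n, m ⊗ₜ p) :=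
    fun m n p => rfl
  have e_symm : ∀ (x : M.Ω ⊗[K] N.Ω) (y : M.Ω ⊗[K] P.Ω), e.symm (x, y) =
      LinearMap.lTensor M.Ω (LinearMap.inl K N.Ω P.Ω) x +
        LinearMap.lTensor M.Ω (LinearMap.inr K N.Ω P.Ω) y := by
    intro x y
    rw [LinearEquiv.symm_apply_eq, map_add]
    have hx : e (LinearMap.lTensor M.Ω (LinearMap.inl K N.Ω P.Ω) x) = (x, 0) := by
      induction x using TensorProduct.induction_on with
      | zero => simp only [map_zero]; rfl
      | tmul a b => simp [e_tmul]
      | add a b ha hb => simp [map_add, ha, hb]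
    have hy : e (LinearMap.lTensor M.Ω (LinearMap.inr K N.Ω P.Ω) y) = (0, y) := by
      induction y using TensorProduct.induction_on with
      | zero => simp only [map_zero]; rfl
      | tmul a b => simp [e_tmul]
      | add a b ha hb => simp [map_add, ha, hb]
    rw [hx, hy]
    simp
  have key : ∀ (A : Submodule K M.Ω) (B : Submodule K N.Ω) (C : Submodule K P.Ω),
      ∀ x ∈ tens A (B.prod C), e x ∈ (tens A B).prod (tens A C) := by
    intro A B C x hx
    have : tens A (B.prod C) ≤ ((tens A B).prod (tens A C)).comap e.toLinearMap :=
      tens_le.2 fun a ha b hb => ⟨tmul_mem_tens ha hb.1, tmul_mem_tens ha hb.2⟩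
    exact this hx
  have key' : ∀ (A : Submodule K M.Ω) (B : Submodule K N.Ω) (C : Submodule K P.Ω),
      ∀ x ∈ (tens A B).prod (tens A C), e.symm x ∈ tens A (B.prod C) := by
    rintro A B C ⟨x, y⟩ ⟨hx, hy⟩
    rw [e_symm]
    have h : tens A B ≤ (tens A (B.prod C)).comap
        (LinearMap.lTensor M.Ω (LinearMap.inl K N.Ω P.Ω)) :=
      tens_le.2 fun a ha b hb => tmul_mem_tens ha ⟨hb, C.zero_mem⟩
    have h' : tens A C ≤ (tens A (B.prod C)).comap
        (LinearMap.lTensor M.Ω (LinearMap.inr K N.Ω P.Ω)) :=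
      tens_le.2 fun a ha b hb => tmul_mem_tens ha ⟨B.zero_mem, hb⟩
    exact Submodule.add_mem _ (h hx) (h' hy)
  refine Isomorphic.ofEquiv (M := tensor M (directSum N P))
    (N := directSum (tensor M N) (tensor M P)) e ?_ (key _ _ _) (key' _ _ _) (key _ _ _)
    (key' _ _ _)
  intro g x
  have : e.toLinearMap ∘ₗ TensorProduct.map (M.ρ g) ((N.ρ.prod P.ρ) g) =
      (((M.ρ.tprod N.ρ).prod (M.ρ.tprod P.ρ)) g) ∘ₗ e.toLinearMap :=
    TensorProduct.ext' fun m ⟨n, p⟩ => rfl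
  exact LinearMap.congr_fun this x

/-! ### The split Grothendieck ring and its quotient by gliders of length zero -/

variable (K G) in
/-- Isomorphism classes of gliders. -/
def setoid : Setoid (Glider K G) where
  r := Isomorphic
  iseqv := ⟨Isomorphic.refl, Isomorphic.symm, Isomorphic.trans⟩

variable (K G) in
/-- The isomorphism classes of gliders of length at most one. -/
def IsoClass : Type (max u v + 1) := Quotient (setoid K G)

/-- The isomorphism class of a glider. -/
def toClass (M : Glider K G) : IsoClass K G := Quotient.mk (setoid K G) M

/-- Multiplication of isomorphism classes is the tensor product, with unit `(K ⊆ K)`. -/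
instance : CommMonoid (IsoClass K G) where
  mul := Quotient.map₂ tensor fun _ _ h _ _ h' => h.tensor h'
  one := toClass (linear 1)
  mul_assoc := by
    rintro ⟨M⟩ ⟨N⟩ ⟨P⟩
    exact Quotient.sound (tensor_assoc M N P)
  one_mul := by
    rintro ⟨M⟩
    exact Quotient.sound (one_tensor M)
  mul_one := by
    rintro ⟨M⟩
    exact Quotient.sound ((tensor_comm M _).trans (one_tensor M))
  mul_comm := by
    rintro ⟨M⟩ ⟨N⟩
    exact Quotient.sound (tensor_comm M N)

theorem toClass_mul (M N : Glider K G) : toClass M * toClass N = toClass (tensor M N) := rfl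

/-- The additive subgroup generated by `S`, as an ideal, when `S` absorbs products with an additive
generating set `T`. -/
def closureIdeal {A : Type*} [CommRing A] (T S : Set A) (hT : AddSubgroup.closure T = ⊤)
    (h : ∀ t ∈ T, ∀ s ∈ S, t * s ∈ AddSubgroup.closure S) : Ideal A where
  carrier := AddSubgroup.closure S
  add_mem' := (AddSubgroup.closure S).add_mem
  zero_mem' := (AddSubgroup.closure S).zero_mem
  smul_mem' := by
    intro c x hx
    have hc : c ∈ AddSubgroup.closure T := hT ▸ AddSubgroup.mem_top c
    change c * x ∈ AddSubgroup.closure S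
    induction hc using AddSubgroup.closure_induction with
    | mem t ht =>
      induction hx using AddSubgroup.closure_induction with
      | mem s hs => exact h t ht s hs
      | zero => rw [mul_zero]; exact AddSubgroup.zero_mem _
      | add a b _ _ ha hb => rw [mul_add]; exact AddSubgroup.add_mem _ ha hb
      | neg a _ ha => rw [mul_neg]; exact AddSubgroup.neg_mem _ ha
    | zero => rw [zero_mul]; exact AddSubgroup.zero_mem _
    | add a b _ _ ha hb => rw [add_mul]; exact AddSubgroup.add_mem _ ha hb
    | neg a _ ha => rw [neg_mul]; exact AddSubgroup.neg_mem _ ha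

/-- The basis element of the free abelian group on isomorphism classes attached to a glider. -/
def basisElt (M : Glider K G) : MonoidAlgebra ℤ (IsoClass K G) :=
  MonoidAlgebra.of ℤ (IsoClass K G) (toClass M)

theorem basisElt_mul (M N : Glider K G) :
    basisElt M * basisElt N = basisElt (tensor M N) := by
  rw [basisElt, basisElt, basisElt, ← map_mul, toClass_mul]

theorem closure_basisElt :
    AddSubgroup.closure (Set.range (basisElt (K := K) (G := G))) = ⊤ := by
  rw [eq_top_iff]
  intro x _
  induction x using MonoidAlgebra.induction_on with
  | of m =>
    obtain ⟨M, rfl⟩ := Quotient.exists_rep m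
    exact AddSubgroup.subset_closure ⟨M, rfl⟩
  | add x y hx hy => exact AddSubgroup.add_mem _ (hx trivial) (hy trivial)
  | smul r x hx => exact AddSubgroup.zsmul_mem _ (hx trivial) r

variable (K G) in
/-- The additive subgroup of the free abelian group on isomorphism classes that is generated by the
elements `[M ⊕ N] - [M] - [N]`; it is an ideal. -/
def splitIdeal : Ideal (MonoidAlgebra ℤ (IsoClass K G)) :=
  closureIdeal (Set.range basisElt)
    {x | ∃ M N : Glider K G, x = basisElt (directSum M N) - basisElt M - basisElt N}
    closure_basisElt (by
      rintro _ ⟨P, rfl⟩ _ ⟨M, N, rfl⟩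
      refine AddSubgroup.subset_closure ⟨tensor P M, tensor P N, ?_⟩
      rw [mul_sub, mul_sub, basisElt_mul, basisElt_mul, basisElt_mul]
      have h : toClass (tensor P (directSum M N)) =
          toClass (directSum (tensor P M) (tensor P N)) :=
        Quotient.sound (tensor_directSum P M N)
      rw [basisElt, h]
      rfl)

variable (K G) in
/-- The split Grothendieck ring of the category of gliders of length at most one: the free abelian
group on isomorphism classes modulo `[M ⊕ N] = [M] + [N]`, with `[M] [N] = [M ⊗ N]`. -/
abbrev K₀split : Type (max u v + 1) := MonoidAlgebra ℤ (IsoClass K G) ⧸ splitIdeal K G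

/-- The class of a glider in the split Grothendieck ring. -/
def cls (M : Glider K G) : K₀split K G := Ideal.Quotient.mk (splitIdeal K G) (basisElt M)

theorem cls_mul (M N : Glider K G) : cls M * cls N = cls (tensor M N) := by
  rw [cls, cls, cls, ← map_mul, basisElt_mul]

theorem closure_cls : AddSubgroup.closure (Set.range (cls (K := K) (G := G))) = ⊤ := by
  rw [eq_top_iff]
  intro x _
  obtain ⟨y, rfl⟩ := Ideal.Quotient.mk_surjective x
  have hy : y ∈ AddSubgroup.closure (Set.range (basisElt (K := K) (G := G))) :=
    closure_basisElt (K := K) (G := G) ▸ AddSubgroup.mem_top y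
  induction hy using AddSubgroup.closure_induction with
  | mem t ht =>
    obtain ⟨M, rfl⟩ := ht
    exact AddSubgroup.subset_closure ⟨M, rfl⟩
  | zero => rw [map_zero]; exact AddSubgroup.zero_mem _
  | add a b _ _ ha hb => rw [map_add]; exact AddSubgroup.add_mem _ (ha trivial) (hb trivial)
  | neg a _ ha => rw [map_neg]; exact AddSubgroup.neg_mem _ (ha trivial)

variable (K G) in
/-- The additive subgroup of the split Grothendieck ring generated by the gliders of essential
length at most zero (`M₁ = 0`); it is an ideal. -/
def lengthZeroIdeal : Ideal (K₀split K G) :=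
  closureIdeal (Set.range (cls (K := K) (G := G)))
    {x | ∃ M : Glider K G, M.M₁ = ⊥ ∧ x = cls M} closure_cls (by
    rintro _ ⟨P, rfl⟩ _ ⟨M, hM, rfl⟩
    refine AddSubgroup.subset_closure ⟨tensor P M, ?_, cls_mul P M⟩
    change tens P.M₁ M.M₁ = ⊥
    rw [eq_bot_iff]
    refine tens_le.2 fun a _ b hb => ?_
    have hb0 : b = 0 := by simpa [hM] using hb
    rw [hb0, TensorProduct.tmul_zero]
    exact Submodule.zero_mem _)

variable (K G) in
/-- The quotient `K^⊕` of the split Grothendieck ring by the gliders of length zero. -/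
abbrev KPlus : Type (max u v + 1) := K₀split K G ⧸ lengthZeroIdeal K G

/-! ### Irreducible gliders and the reduced glider representation ring -/

/-- A glider of length exactly one is irreducible if every proper subglider `(N₁ ⊆ N₀)` is trivial,
that is, of strictly smaller length: `N₁ = 0`. -/
def IsIrreducible (M : Glider K G) : Prop :=
  M.M₁ ≠ ⊥ ∧ ∀ N₀ N₁ : Submodule K M.Ω, N₁ ≤ N₀ → N₀ ≤ M.M₀ → N₁ ≤ M.M₁ →
    (∀ g : G, ∀ n ∈ N₁, M.ρ g n ∈ N₀) → ¬ (N₀ = M.M₀ ∧ N₁ = M.M₁) → N₁ = ⊥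

variable (K G) in
/-- The subring of the split Grothendieck ring generated by the irreducible gliders of length one. -/
def R₁ : Subring (K₀split K G) :=
  Subring.closure {x | ∃ M : Glider K G, M.IsIrreducible ∧ x = cls M}

variable (K G) in
/-- The reduced glider representation ring of length one: the image of `R₁` in `K^⊕`. -/
def RBar : Subring (KPlus K G) := (R₁ K G).map (Ideal.Quotient.mk (lengthZeroIdeal K G))

variable (K G) in
/-- The `ℚ`-algebra `ℚ(G̃) = ℚ ⊗ RBar`. -/
abbrev QAlg : Type (max u v + 1) := ℚ ⊗[ℤ] (RBar K G)

/-- The class of an irreducible glider in the reduced glider representation ring. -/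
def redClass (M : Glider K G) (hM : M.IsIrreducible) : RBar K G :=
  ⟨Ideal.Quotient.mk (lengthZeroIdeal K G) (cls M),
    ⟨cls M, Subring.subset_closure ⟨M, hM, rfl⟩, rfl⟩⟩

/-- The class of an irreducible glider in `ℚ(G̃)`. -/
def qClass (M : Glider K G) (hM : M.IsIrreducible) : QAlg K G := (1 : ℚ) ⊗ₜ[ℤ] redClass M hM

/-! ### The parameters `(A, B)` of an irreducible glider -/

variable (K G) in
/-- An irreducible representation of dimension at least two. -/
structure NonlinearIrrep where
  V : Type (max u v)
  [instAddCommGroup : AddCommGroup V]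
  [instModule : Module K V]
  σ : Representation K G V
  irreducible : σ.IsIrreducible
  two_le : 1 < Module.finrank K V

attribute [instance] NonlinearIrrep.instAddCommGroup NonlinearIrrep.instModule

/-- The parameter `A` of a glider `(M₁ ⊆ M₀)` with `M₀ = K[G] M₁`: the set of one-dimensional
representations `T_χ` which occur in `M₀`. -/
def linearPart (M : Glider K G) : Set (G →* Kˣ) :=
  {χ | ∃ m ∈ M.M₀, m ≠ 0 ∧ ∀ g, M.ρ g m = ((χ g : Kˣ) : K) • m}

/-- The parameter `B` of a glider `(M₁ ⊆ M₀)` with `M₀ = K[G] M₁`: for every irreducible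
representation `U` of dimension at least two, the subspace of `U` formed by the images of `M₁` under
the homomorphisms `M₀ → U`. If `M₁` is the line through `(u₁, …, u_j, …)` in
`M₀ = U^j ⊕ …` (no `U` in the remaining summand), this is the point `span(u₁, …, u_j)` of the
Grassmannian `Gr(j, U)`; the zero subspace means that `B` has no point over `U`. -/
def nonlinearPart (M : Glider K G) (U : NonlinearIrrep K G) : Submodule K U.V :=
  Submodule.span K {x | ∃ f : M.M₀ →ₗ[K] U.V,
    (∀ (g : G) (m : M.Ω) (hm : m ∈ M.M₁),
      f ⟨M.ρ g m, M.smul_mem g m hm⟩ = U.σ g (f ⟨m, M.le hm⟩)) ∧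
    ∃ (m : M.Ω) (hm : m ∈ M.M₁), f ⟨m, M.le hm⟩ = x}

/-- `M` is the irreducible glider `M_(A,B)` (up to isomorphism). -/
def IsParam (M : Glider K G) (A : Set (G →* Kˣ)) (B : ∀ U : NonlinearIrrep K G, Submodule K U.V) :
    Prop :=
  M.IsIrreducible ∧ M.linearPart = A ∧ M.nonlinearPart = B

/-! ### The obstruction module `R` and the group algebra of `G^ab` -/

/-- `e` is the idempotent of the cyclic semigroup generated by `x`; it exists if and only if that
semigroup is finite, and is then unique. -/
def IsAssociatedIdempotent {A : Type*} [Monoid A] (x e : A) : Prop :=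
  e * e = e ∧ ∃ n : ℕ, 1 ≤ n ∧ x ^ n = e

variable (K G) in
/-- The obstruction module `R(G)`: the `ℚ`-subspace of `ℚ(G̃)` spanned by the classes of
irreducible gliders whose associated idempotent exists and is of the form `M_({T_G}, D)`. -/
def obstructionR : Submodule ℚ (QAlg K G) :=
  Submodule.span ℚ {x | ∃ (M : Glider K G) (hM : M.IsIrreducible), x = qClass M hM ∧
    ∃ (N : Glider K G) (hN : N.IsIrreducible) (D : ∀ U : NonlinearIrrep K G, Submodule K U.V),
      IsParam N {1} D ∧ IsAssociatedIdempotent x (qClass N hN)}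

theorem linear_isIrreducible (χ : G →* Kˣ) : (linear χ : Glider K G).IsIrreducible := by
  have hs : IsSimpleOrder (Submodule K (ULift.{v} K)) :=
    (Submodule.orderIsoMapComap
      (ULift.moduleEquiv (R := K) (M := K) : ULift.{v} K ≃ₗ[K] K)).isSimpleOrder_iff.2 inferInstance
  refine ⟨fun h => top_ne_bot (α := Submodule K (ULift.{v} K)) h, ?_⟩
  intro N₀ N₁ h _ _ _ hne
  rcases hs.eq_bot_or_eq_top N₁ with h' | h'
  · exact h'
  · exact absurd ⟨top_le_iff.1 (h' ▸ h), h'⟩ hne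

/-- The group homomorphism `χ ↦ M_({χ}, ∅) = [K ⊆ T_χ]` into `ℚ(G̃)`. -/
def linearHom : (G →* Kˣ) →* QAlg K G where
  toFun χ := qClass (linear χ) (linear_isIrreducible χ)
  map_one' := rfl
  map_mul' χ ψ := by
    rw [qClass, qClass, qClass, Algebra.TensorProduct.tmul_mul_tmul, one_mul]
    congr 1
    refine Subtype.ext ?_
    change _ = Ideal.Quotient.mk (lengthZeroIdeal K G) (cls (linear χ)) *
      Ideal.Quotient.mk (lengthZeroIdeal K G) (cls (linear ψ))
    rw [← map_mul, cls_mul]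
    change Ideal.Quotient.mk _ (Ideal.Quotient.mk _ (basisElt _)) =
      Ideal.Quotient.mk _ (Ideal.Quotient.mk _ (basisElt _))
    rw [basisElt, basisElt, toClass, toClass, Quotient.sound (linear_tensor χ ψ)]

/-- The map `ℚ[G^ab] → ℚ(G̃)`, `z ↦ M_({z}, ∅)`, for an identification `z ↦ T_z` of `G^ab` with
the group of one-dimensional representations of `G`. -/
def groupAlgebraMap (τ : Abelianization G ≃* (G →* Kˣ)) :
    MonoidAlgebra ℚ (Abelianization G) →ₐ[ℚ] QAlg K G :=
  MonoidAlgebra.lift ℚ (QAlg K G) (Abelianization G) (linearHom.comp τ.toMonoidHom)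

/-! ### Induction -/

/-- The glider induced from a glider of a subgroup `H` of the finite group `G`: the overlying module
is the induced module of `Ω`, its member in degree `-1` is `1 ⊗ M₁`, and its member in degree `0` is
`∑ g ⊗ M₀`, the induced module of `M₀` (when `M₀` is `H`-stable, as for irreducible gliders). -/
abbrev induced [Finite G] (H : Subgroup G) (M : Glider K H) : Glider K G where
  Ω := Representation.IndV H.subtype M.ρ
  ρ := Representation.ind H.subtype M.ρ
  M₀ := ⨆ g : G, M.M₀.map (Representation.IndV.mk H.subtype M.ρ g)
  M₁ := M.M₁.map (Representation.IndV.mk H.subtype M.ρ 1)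
  le := le_iSup_of_le 1 (Submodule.map_mono M.le)
  smul_mem := by
    rintro g _ ⟨m, hm, rfl⟩
    rw [Representation.ind_mk]
    exact Submodule.mem_iSup_of_mem (1 * g⁻¹) ⟨m, M.le hm, rfl⟩
  finite := inferInstance

end

end Glider

namespace Glider

noncomputable section

variable {K : Type u} {G : Type v} [Field K] [Group G]

/-! ### Spaces of matrix coefficients -/

section Coefficients

variable {V V' : Type*} [AddCommGroup V] [Module K V] [AddCommGroup V'] [Module K V']

/-! To a vector `m` of a representation attach the space `C(m)` of functions `g ↦ l (g m)` on `G`.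
For gliders whose degree `-1` part is a line `K m`, the class modulo gliders of length zero is the
same datum as `C(m)`: equal spaces give equal classes (`plusClass_eq_of_coeffSpace_eq`). Conversely,
for each `W ⊆ K^G` the number `dim {m ∈ M₁ | C(m) ⊆ W}` is additive and kills length zero, and on
such a glider it is the indicator of `C(m) ⊆ W`. Tensor products become products of subspaces of
`K^G` (`coeffSpace_tmul`), so relations between powers of classes can be checked in `K^G`
(`qClass_pow_eq_iff`).

An idempotent `M_({T_G}, D)` then corresponds to a left-translation-stable subalgebra of `K^G`, that
is, to the functions on `G/H` for some subgroup `H` (`exists_eq_rightInvariants`). The linear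
characters occurring in it are those trivial on `H`, so the condition on its parameter `A` says that
only the trivial character kills `H`.

If `G` is nilpotent, every proper subgroup is killed by a nontrivial character, so `H = G` and the
idempotent is the unit. A translation-stable space with a power equal to the constants is spanned by
a character (`exists_eq_span_charFun`), so `R` contains only combinations of one-dimensional
gliders.

If `H` is maximal and not normal, the kernel of a character killing `H` is normal and contains `H`,
so it is `G`. The functions on `G/H` therefore give an idempotent in `R`, and the counting
functionals separate it from all combinations of characters. A finite group is nilpotent exactly
when its maximal subgroups are normal, which gives the equivalence. -/

/-- The space of matrix coefficients `g ↦ l (g m)` of a vector `m`. -/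
def coeffSpace (ρ : Representation K G V) (m : V) : Submodule K (G → K) :=
  LinearMap.range (LinearMap.pi fun g => Module.Dual.eval K V (ρ g m))

theorem mem_coeffSpace {ρ : Representation K G V} {m : V} {f : G → K} :
    f ∈ coeffSpace ρ m ↔ ∃ l : Module.Dual K V, ∀ g, f g = l (ρ g m) := by
  constructor
  · rintro ⟨l, rfl⟩
    exact ⟨l, fun _ => rfl⟩
  · rintro ⟨l, h⟩
    exact ⟨l, funext fun g => (h g).symm⟩

theorem apply_mem_coeffSpace (ρ : Representation K G V) (m : V) (l : Module.Dual K V) :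
    (fun g => l (ρ g m)) ∈ coeffSpace ρ m :=
  mem_coeffSpace.2 ⟨l, fun _ => rfl⟩

theorem coeffSpace_zero (ρ : Representation K G V) : coeffSpace ρ 0 = ⊥ := by
  rw [eq_bot_iff]
  intro f hf
  obtain ⟨l, h⟩ := mem_coeffSpace.1 hf
  exact (Submodule.mem_bot K).2 (funext fun g => by simp [h])

theorem coeffSpace_ne_bot {ρ : Representation K G V} {m : V} (hm : m ≠ 0) :
    coeffSpace ρ m ≠ ⊥ := by
  obtain ⟨l, hl⟩ : ∃ l : Module.Dual K V, l m ≠ 0 := by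
    by_contra! h
    exact hm ((Module.forall_dual_apply_eq_zero_iff K m).1 h)
  intro h
  have h₀ := apply_mem_coeffSpace ρ m l
  rw [h, Submodule.mem_bot] at h₀
  exact hl (by simpa using congrFun h₀ 1)

/-- Translating the argument on the left by `h` replaces `l` by `l ∘ ρ h`. This stability is what
later produces subgroups and characters from coefficient spaces. -/
theorem coeffSpace_translate {ρ : Representation K G V} {m : V} {f : G → K}
    (hf : f ∈ coeffSpace ρ m) (h : G) : (fun g => f (h * g)) ∈ coeffSpace ρ m := by
  obtain ⟨l, hl⟩ := mem_coeffSpace.1 hf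
  exact mem_coeffSpace.2 ⟨l ∘ₗ ρ h, fun g => by simp [hl]⟩

theorem coeffSpace_add_le (ρ : Representation K G V) (m n : V) :
    coeffSpace ρ (m + n) ≤ coeffSpace ρ m ⊔ coeffSpace ρ n := by
  intro f hf
  obtain ⟨l, h⟩ := mem_coeffSpace.1 hf
  refine Submodule.mem_sup.2 ⟨_, apply_mem_coeffSpace ρ m l, _, apply_mem_coeffSpace ρ n l, ?_⟩
  funext g
  simp [h]

theorem coeffSpace_smul_le (ρ : Representation K G V) (c : K) (m : V) :
    coeffSpace ρ (c • m) ≤ coeffSpace ρ m := by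
  intro f hf
  obtain ⟨l, h⟩ := mem_coeffSpace.1 hf
  exact mem_coeffSpace.2 ⟨c • l, fun g => by simp [h]⟩

/-- A functional on a product is a pair of functionals. Since a supremum lies in `W` exactly when
both terms do, this makes the counting invariants additive. -/
theorem coeffSpace_prod (ρ : Representation K G V) (σ : Representation K G V') (m : V) (n : V') :
    coeffSpace (ρ.prod σ) (m, n) = coeffSpace ρ m ⊔ coeffSpace σ n := by
  apply le_antisymm
  · intro f hf
    obtain ⟨l, h⟩ := mem_coeffSpace.1 hf
    refine Submodule.mem_sup.2 ⟨_, apply_mem_coeffSpace ρ m (l ∘ₗ LinearMap.inl K V V'), _,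
      apply_mem_coeffSpace σ n (l ∘ₗ LinearMap.inr K V V'), ?_⟩
    funext g
    rw [h, Pi.add_apply, LinearMap.comp_apply, LinearMap.comp_apply, ← map_add]
    simp
  · refine sup_le ?_ ?_
    · intro f hf
      obtain ⟨l, h⟩ := mem_coeffSpace.1 hf
      exact mem_coeffSpace.2 ⟨l ∘ₗ LinearMap.fst K V V', h⟩
    · intro f hf
      obtain ⟨l, h⟩ := mem_coeffSpace.1 hf
      exact mem_coeffSpace.2 ⟨l ∘ₗ LinearMap.snd K V V', h⟩

/-- The orbit of `m` spans a finite-dimensional space; expanding `g m` in a basis of it turns any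
coefficient of `m ⊗ n` into a finite sum of products of coefficients. -/
theorem coeffSpace_tmul [Finite G] (ρ : Representation K G V) (σ : Representation K G V')
    (m : V) (n : V') :
    coeffSpace (ρ.tprod σ) (m ⊗ₜ n) = coeffSpace ρ m * coeffSpace σ n := by
  apply le_antisymm
  · intro f hf
    obtain ⟨l, h⟩ := mem_coeffSpace.1 hf
    let S := Submodule.span K (Set.range fun g => ρ g m)
    have : FiniteDimensional K S := FiniteDimensional.span_of_finite K (Set.finite_range _)
    let b := Module.finBasis K S
    -- The coordinate functionals are only defined on the span of the orbit, so they are extended to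
    -- `V`.
    choose ε hε using fun i => LinearMap.exists_extend (b.coord i)
    have hS : ∀ g, ρ g m ∈ S := fun g => Submodule.subset_span ⟨g, rfl⟩
    have hsum : ∀ g, ∑ i, ε i (ρ g m) • (b i : V) = ρ g m := fun g => by
      have h₁ : ∀ i, ε i (ρ g m) = b.repr ⟨ρ g m, hS g⟩ i := fun i =>
        LinearMap.congr_fun (hε i) ⟨ρ g m, hS g⟩
      have h₂ := congrArg S.subtype (b.sum_repr ⟨ρ g m, hS g⟩)
      rw [map_sum] at h₂
      simpa only [h₁, map_smul, Submodule.subtype_apply] using h₂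
    have hf' : f = ∑ i, (fun g => ε i (ρ g m)) *
        fun g => (l ∘ₗ TensorProduct.mk K V V' (b i)) (σ g n) := by
      funext g
      rw [h, Representation.tprod_apply, TensorProduct.map_tmul]
      conv_lhs => rw [← hsum g]
      rw [TensorProduct.sum_tmul, map_sum, Finset.sum_apply]
      refine Finset.sum_congr rfl fun i _ => ?_
      rw [← TensorProduct.smul_tmul', map_smul]
      rfl
    rw [hf']
    exact Submodule.sum_mem _ fun i _ => Submodule.mul_mem_mul (apply_mem_coeffSpace ρ m _)
      (apply_mem_coeffSpace σ n _)
  · refine Submodule.mul_le.2 fun f hf f' hf' => ?_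
    obtain ⟨l, h⟩ := mem_coeffSpace.1 hf
    obtain ⟨l', h'⟩ := mem_coeffSpace.1 hf'
    refine mem_coeffSpace.2 ⟨(TensorProduct.lid K K).toLinearMap ∘ₗ TensorProduct.map l l',
      fun g => ?_⟩
    simp [h, h']

/-- An inclusion of coefficient spaces gives a linear map matching the two orbits. -/
theorem exists_map_of_coeffSpace_le {ρ : Representation K G V} {σ : Representation K G V'}
    {m : V} {n : V'} (h : coeffSpace σ n ≤ coeffSpace ρ m) (A : Submodule K V)
    (B : Submodule K V') (hA : ∀ g, ρ g m ∈ A) (hB : ∀ g, σ g n ∈ B) :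
    ∃ f : A →ₗ[K] B, ∀ g, f ⟨ρ g m, hA g⟩ = ⟨σ g n, hB g⟩ := by
  let S : (G →₀ K) →ₗ[K] A := Finsupp.linearCombination K fun g => ⟨ρ g m, hA g⟩
  let T : (G →₀ K) →ₗ[K] B := Finsupp.linearCombination K fun g => ⟨σ g n, hB g⟩
  have hS : ∀ g, S (Finsupp.single g 1) = ⟨ρ g m, hA g⟩ := fun g => by simp [S]
  have hT : ∀ g, T (Finsupp.single g 1) = ⟨σ g n, hB g⟩ := fun g => by simp [T]
  -- A linear relation among the `g m` also holds among the `g n`: a functional tested on the latter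
  -- is a coefficient of `n`, hence one of `m`.
  have hker : LinearMap.ker S ≤ LinearMap.ker T := by
    intro a ha
    rw [LinearMap.mem_ker] at ha ⊢
    refine Subtype.ext ((Module.forall_dual_apply_eq_zero_iff K _).1 fun l => ?_)
    obtain ⟨l', hl'⟩ := mem_coeffSpace.1 (h (apply_mem_coeffSpace σ n l))
    have key : l ∘ₗ B.subtype ∘ₗ T = l' ∘ₗ A.subtype ∘ₗ S := by
      ext g
      simpa [hS, hT] using hl' g
    have := LinearMap.congr_fun key a
    simpa [ha] using this
  let f₀ : LinearMap.range S →ₗ[K] B :=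
    (LinearMap.ker S).liftQ T hker ∘ₗ S.quotKerEquivRange.symm.toLinearMap
  obtain ⟨f, hf⟩ := LinearMap.exists_extend f₀
  refine ⟨f, fun g => ?_⟩
  rw [← hS, ← hT]
  have h₁ := LinearMap.congr_fun hf ⟨S (Finsupp.single g 1), ⟨_, rfl⟩⟩
  refine h₁.trans ?_
  have h₂ : S.quotKerEquivRange.symm ⟨S (Finsupp.single g 1), ⟨_, rfl⟩⟩ =
      (LinearMap.ker S).mkQ (Finsupp.single g 1) := by
    rw [LinearEquiv.symm_apply_eq]
    rfl
  change (LinearMap.ker S).liftQ T hker (S.quotKerEquivRange.symm _) = _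
  rw [h₂]
  rfl

end Coefficients

/-! ### Additive invariants of gliders -/

/-- The vectors of `M₁` whose matrix coefficients lie in `W`. -/
def coeffSub (M : Glider K G) (W : Submodule K (G → K)) : Submodule K M.Ω where
  carrier := {m | m ∈ M.M₁ ∧ coeffSpace M.ρ m ≤ W}
  add_mem' ha hb := ⟨M.M₁.add_mem ha.1 hb.1,
    (coeffSpace_add_le _ _ _).trans (sup_le ha.2 hb.2)⟩
  zero_mem' := ⟨M.M₁.zero_mem, (coeffSpace_zero M.ρ).trans_le bot_le⟩
  smul_mem' c _ ha := ⟨M.M₁.smul_mem c ha.1, (coeffSpace_smul_le _ _ _).trans ha.2⟩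

theorem mem_coeffSub {M : Glider K G} {W : Submodule K (G → K)} {m : M.Ω} :
    m ∈ coeffSub M W ↔ m ∈ M.M₁ ∧ coeffSpace M.ρ m ≤ W := Iff.rfl

theorem coeffSub_le (M : Glider K G) (W : Submodule K (G → K)) : coeffSub M W ≤ M.M₀ :=
  fun _ hm => M.le hm.1

instance (M : Glider K G) (W : Submodule K (G → K)) : Module.Finite K (coeffSub M W) :=
  Submodule.finiteDimensional_of_le (coeffSub_le M W)

/-- A functional on the target pulls back along `f` to `M₀` and extends to `Ω`; equivariance on `M₁`
suffices because only the orbit of `m` is evaluated. -/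
theorem IsHom.coeffSpace_le {M N : Glider K G} {f : M.M₀ →ₗ[K] N.M₀} (hf : IsHom M N f) {m : M.Ω}
    (hm : m ∈ M.M₁) : coeffSpace N.ρ (f ⟨m, M.le hm⟩ : N.Ω) ≤ coeffSpace M.ρ m := by
  intro φ hφ
  obtain ⟨l, hl⟩ := mem_coeffSpace.1 hφ
  obtain ⟨l', hl'⟩ := LinearMap.exists_extend (l ∘ₗ N.M₀.subtype ∘ₗ f)
  refine mem_coeffSpace.2 ⟨l', fun g => ?_⟩
  have := LinearMap.congr_fun hl' ⟨M.ρ g m, M.smul_mem g m hm⟩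
  refine (hl g).trans (Eq.trans ?_ this.symm)
  exact congrArg l (hf.2 g m hm).symm

theorem IsHom.finrank_coeffSub_le {M N : Glider K G} {f : M.M₀ →ₗ[K] N.M₀} (hf : IsHom M N f)
    (hinj : Function.Injective f) (W : Submodule K (G → K)) :
    Module.finrank K (coeffSub M W) ≤ Module.finrank K (coeffSub N W) := by
  let F : coeffSub M W →ₗ[K] coeffSub N W :=
    LinearMap.codRestrict (coeffSub N W)
      (N.M₀.subtype ∘ₗ f ∘ₗ Submodule.inclusion (coeffSub_le M W))
      fun x => ⟨hf.1 x x.2.1, (hf.coeffSpace_le x.2.1).trans x.2.2⟩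
  refine LinearMap.finrank_le_finrank_of_injective (f := F) fun x y hxy => ?_
  have h : (f (Submodule.inclusion (coeffSub_le M W) x) : N.Ω) =
      f (Submodule.inclusion (coeffSub_le M W) y) := congrArg (Subtype.val (p := (· ∈ coeffSub N W))) hxy
  exact Submodule.inclusion_injective _ (hinj (Subtype.ext h))

theorem Isomorphic.finrank_coeffSub {M N : Glider K G} (h : Isomorphic M N)
    (W : Submodule K (G → K)) :
    Module.finrank K (coeffSub M W) = Module.finrank K (coeffSub N W) := by
  obtain ⟨e, h₁, h₂⟩ := h
  exact le_antisymm (h₁.finrank_coeffSub_le e.injective W) (h₂.finrank_coeffSub_le e.symm.injective W)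

theorem finrank_coeffSub_directSum (M N : Glider K G) (W : Submodule K (G → K)) :
    Module.finrank K (coeffSub (directSum M N) W) =
      Module.finrank K (coeffSub M W) + Module.finrank K (coeffSub N W) := by
  rw [← Module.finrank_prod]
  have hmem : ∀ x : M.Ω × N.Ω, x ∈ coeffSub (directSum M N) W ↔
      x.1 ∈ coeffSub M W ∧ x.2 ∈ coeffSub N W := by
    rintro ⟨m, n⟩
    refine mem_coeffSub.trans ?_
    rw [show (directSum M N).ρ = M.ρ.prod N.ρ from rfl, coeffSpace_prod, sup_le_iff]
    exact ⟨fun h => ⟨⟨h.1.1, h.2.1⟩, h.1.2, h.2.2⟩, fun h => ⟨⟨h.1.1, h.2.1⟩, h.1.2, h.2.2⟩⟩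
  refine LinearEquiv.finrank_eq
    { toFun := fun x => (⟨x.1.1, ((hmem _).1 x.2).1⟩, ⟨x.1.2, ((hmem _).1 x.2).2⟩)
      invFun := fun x => ⟨(x.1, x.2), (hmem _).2 ⟨x.1.2, x.2.2⟩⟩
      map_add' := fun _ _ => rfl
      map_smul' := fun _ _ => rfl
      left_inv := fun _ => rfl
      right_inv := fun _ => rfl }

/-- The invariant `dim {m ∈ M₁ | coeffSpace m ≤ W}` of an isomorphism class. -/
def countClass (W : Submodule K (G → K)) : IsoClass K G → ℤ :=
  Quotient.lift (fun M : Glider K G => (Module.finrank K (coeffSub M W) : ℤ))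
    fun _ _ h => congrArg Nat.cast (Isomorphic.finrank_coeffSub h W)

/-- The additive function `M ↦ dim {m ∈ M₁ | coeffSpace m ≤ W}` on the free abelian group on
isomorphism classes. -/
def countFree (W : Submodule K (G → K)) : MonoidAlgebra ℤ (IsoClass K G) →+ ℤ :=
  MonoidAlgebra.liftNC (AddMonoidHom.id ℤ) (countClass W)

theorem countFree_basisElt (W : Submodule K (G → K)) (M : Glider K G) :
    countFree W (basisElt M) = Module.finrank K (coeffSub M W) := by
  rw [countFree, basisElt, MonoidAlgebra.of_apply, MonoidAlgebra.liftNC_single]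
  exact one_mul _

/-- The additive function `countFree` on the split Grothendieck ring. -/
def countSplit (W : Submodule K (G → K)) : K₀split K G →+ ℤ :=
  AddMonoidHom.liftOfSurjective (Ideal.Quotient.mk (splitIdeal K G)).toAddMonoidHom
    Ideal.Quotient.mk_surjective ⟨countFree W, by
      intro x hx
      have hx' : x ∈ splitIdeal K G := Ideal.Quotient.eq_zero_iff_mem.1 hx
      have hle : AddSubgroup.closure {x | ∃ M N : Glider K G,
          x = basisElt (directSum M N) - basisElt M - basisElt N} ≤ (countFree W).ker := by
        rw [AddSubgroup.closure_le]
        rintro _ ⟨M, N, rfl⟩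
        rw [SetLike.mem_coe, AddMonoidHom.mem_ker, map_sub, map_sub, countFree_basisElt,
          countFree_basisElt, countFree_basisElt, finrank_coeffSub_directSum]
        push_cast
        ring
      exact hle hx'⟩

theorem countSplit_cls (W : Submodule K (G → K)) (M : Glider K G) :
    countSplit W (cls M) = Module.finrank K (coeffSub M W) := by
  rw [← countFree_basisElt]
  exact AddMonoidHom.liftOfRightInverse_comp_apply _ _ _ _ (basisElt M)

/-- The additive function `countFree` on the quotient by the gliders of length zero. -/
def countPlus (W : Submodule K (G → K)) : KPlus K G →+ ℤ :=
  AddMonoidHom.liftOfSurjective (Ideal.Quotient.mk (lengthZeroIdeal K G)).toAddMonoidHom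
    Ideal.Quotient.mk_surjective ⟨countSplit W, by
      intro x hx
      have hx' : x ∈ lengthZeroIdeal K G := Ideal.Quotient.eq_zero_iff_mem.1 hx
      have hle : AddSubgroup.closure {x | ∃ M : Glider K G, M.M₁ = ⊥ ∧ x = cls M} ≤
          (countSplit W).ker := by
        rw [AddSubgroup.closure_le]
        rintro _ ⟨M, hM, rfl⟩
        have h : coeffSub M W = ⊥ := eq_bot_iff.2 fun x hx => hM ▸ hx.1
        rw [SetLike.mem_coe, AddMonoidHom.mem_ker, countSplit_cls, h, finrank_bot, Nat.cast_zero]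
      exact hle hx'⟩

/-- The class of a glider modulo gliders of length zero. -/
def plusClass (M : Glider K G) : KPlus K G := Ideal.Quotient.mk (lengthZeroIdeal K G) (cls M)

theorem countPlus_plusClass (W : Submodule K (G → K)) (M : Glider K G) :
    countPlus W (plusClass M) = Module.finrank K (coeffSub M W) := by
  rw [← countSplit_cls]
  exact AddMonoidHom.liftOfRightInverse_comp_apply _ _ _ _ (cls M)

/-! ### Rules for classes modulo gliders of length zero -/

theorem plusClass_mul (M N : Glider K G) :
    plusClass M * plusClass N = plusClass (tensor M N) := by
  rw [plusClass, plusClass, plusClass, ← map_mul, cls_mul]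

theorem plusClass_directSum (M N : Glider K G) :
    plusClass (directSum M N) = plusClass M + plusClass N := by
  rw [plusClass, plusClass, plusClass, ← map_add]
  congr 1
  rw [cls, cls, cls, ← map_add, Ideal.Quotient.eq, ← sub_sub]
  exact AddSubgroup.subset_closure ⟨M, N, rfl⟩

theorem plusClass_eq_zero {M : Glider K G} (hM : M.M₁ = ⊥) : plusClass M = 0 :=
  Ideal.Quotient.eq_zero_iff_mem.2 (AddSubgroup.subset_closure ⟨M, hM, rfl⟩)

theorem Isomorphic.plusClass_eq {M N : Glider K G} (h : Isomorphic M N) :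
    plusClass M = plusClass N := by
  rw [plusClass, plusClass, cls, cls, basisElt, basisElt, toClass, toClass, Quotient.sound h]

/-- The `ℚ`-linear extension of `countPlus` to `ℚ(G̃)`. -/
def countQ (W : Submodule K (G → K)) : QAlg K G →ₗ[ℚ] ℚ :=
  (TensorProduct.AlgebraTensorModule.rid ℤ ℚ ℚ).toLinearMap ∘ₗ
    LinearMap.baseChange ℚ ((countPlus W).comp (RBar K G).subtype.toAddMonoidHom).toIntLinearMap

theorem countQ_tmul (W : Submodule K (G → K)) (q : ℚ) (r : RBar K G) :
    countQ W (q ⊗ₜ r) = (countPlus W (r : KPlus K G) : ℚ) * q := by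
  simp [countQ]

/-! ### Gliders generated by one vector in degree `-1` -/

/-- `M₁` is the line through `m`. -/
def IsGeneratedBy (M : Glider K G) (m : M.Ω) : Prop := m ≠ 0 ∧ M.M₁ = Submodule.span K {m}

theorem IsGeneratedBy.mem {M : Glider K G} {m : M.Ω} (h : M.IsGeneratedBy m) : m ∈ M.M₁ :=
  h.2 ▸ Submodule.mem_span_singleton_self m

-- Nonzero multiples of `m` have the same coefficient space, so the count is all or nothing. Letting
-- `W` vary recovers the coefficient space of `m`.
open scoped Classical in
theorem IsGeneratedBy.finrank_coeffSub {M : Glider K G} {m : M.Ω} (h : M.IsGeneratedBy m)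
    (W : Submodule K (G → K)) :
    Module.finrank K (coeffSub M W) = if coeffSpace M.ρ m ≤ W then 1 else 0 := by
  split_ifs with hW
  · have : coeffSub M W = Submodule.span K {m} := by
      apply le_antisymm
      · exact fun x hx => h.2 ▸ hx.1
      · rw [Submodule.span_singleton_le_iff_mem]
        exact ⟨h.mem, hW⟩
    rw [this, finrank_span_singleton h.1]
  · have : coeffSub M W = ⊥ := by
      rw [eq_bot_iff]
      intro x hx
      obtain ⟨c, rfl⟩ := Submodule.mem_span_singleton.1 (h.2 ▸ hx.1)
      by_cases hc : c = 0
      · simp [hc]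
      · refine absurd (le_trans ?_ hx.2) hW
        have := coeffSpace_smul_le M.ρ c⁻¹ (c • m)
        rwa [inv_smul_smul₀ hc] at this
    rw [this, finrank_bot]

theorem IsGeneratedBy.tensor {M N : Glider K G} {m : M.Ω} {n : N.Ω} (hm : M.IsGeneratedBy m)
    (hn : N.IsGeneratedBy n) : (tensor M N).IsGeneratedBy (m ⊗ₜ n) := by
  refine ⟨?_, le_antisymm (tens_le.2 ?_) ?_⟩
  · intro h
    obtain ⟨l, hl⟩ := not_forall.1 (mt (Module.forall_dual_apply_eq_zero_iff K m).1 hm.1)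
    obtain ⟨l', hl'⟩ := not_forall.1 (mt (Module.forall_dual_apply_eq_zero_iff K n).1 hn.1)
    have h₀ := congrArg ((TensorProduct.lid K K).toLinearMap ∘ₗ TensorProduct.map l l') h
    simp [hl, hl'] at h₀
  · intro a ha b hb
    obtain ⟨c, rfl⟩ := Submodule.mem_span_singleton.1 (hm.2 ▸ ha)
    obtain ⟨d, rfl⟩ := Submodule.mem_span_singleton.1 (hn.2 ▸ hb)
    rw [TensorProduct.smul_tmul_smul]
    exact Submodule.smul_mem _ _ (Submodule.mem_span_singleton_self _)
  · rw [Submodule.span_singleton_le_iff_mem]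
    exact tmul_mem_tens hm.mem hn.mem

theorem linear_isGeneratedBy (χ : G →* Kˣ) :
    (linear χ : Glider K G).IsGeneratedBy (ULift.up 1) := by
  refine ⟨fun h => one_ne_zero (α := K) (congrArg ULift.down h), ?_⟩
  refine (Submodule.eq_top_iff'.2 fun x => Submodule.mem_span_singleton.2 ⟨x.down, ?_⟩).symm
  exact ULift.ext _ _ (mul_one _)

/-- A linear character as a function with values in `K`. -/
def charFun (χ : G →* Kˣ) : G → K := fun g => χ g

theorem coeffSpace_linear (χ : G →* Kˣ) :
    coeffSpace (linear χ : Glider K G).ρ (ULift.up 1) = Submodule.span K {charFun χ} := by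
  have h : ∀ (l : Module.Dual K (ULift.{v} K)) (g : G), l ((linear χ).ρ g (ULift.up 1)) =
      l (ULift.up 1) * charFun χ g := fun l g => by
    rw [linear_ρ, map_smul, smul_eq_mul, mul_comm]
    rfl
  ext f
  rw [mem_coeffSpace, Submodule.mem_span_singleton]
  constructor
  · rintro ⟨l, hl⟩
    exact ⟨l (ULift.up 1), funext fun g => by rw [hl, h]; rfl⟩
  · rintro ⟨c, rfl⟩
    refine ⟨c • (down K).toLinearMap, fun g => ?_⟩
    rw [h]
    have : down K (ULift.up 1 : ULift.{v} K) = 1 := rfl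
    simp [this]

/-- The glider `0 ⊆ M₀`. -/
abbrev lengthZero (M : Glider K G) : Glider K G where
  Ω := M.Ω
  ρ := M.ρ
  M₀ := M.M₀
  M₁ := ⊥
  le := bot_le
  smul_mem g m hm := by
    rw [Submodule.mem_bot] at hm
    rw [hm, map_zero]
    exact Submodule.zero_mem _
  finite := M.finite

/-- Gliders generated by vectors with the same matrix coefficients have the same class modulo gliders
of length zero. -/
theorem plusClass_eq_of_coeffSpace_eq {M N : Glider K G} {m : M.Ω} {n : N.Ω}
    (hm : M.IsGeneratedBy m) (hn : N.IsGeneratedBy n)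
    (h : coeffSpace M.ρ m = coeffSpace N.ρ n) : plusClass M = plusClass N := by
  have hM : ∀ g, M.ρ g m ∈ M.M₀ := fun g => M.smul_mem g m hm.mem
  have hN : ∀ g, N.ρ g n ∈ N.M₀ := fun g => N.smul_mem g n hn.mem
  obtain ⟨f, hf⟩ := exists_map_of_coeffSpace_le h.ge M.M₀ N.M₀ hM hN
  obtain ⟨f', hf'⟩ := exists_map_of_coeffSpace_le h.le N.M₀ M.M₀ hN hM
  have hf₁ : f ⟨m, M.le hm.mem⟩ = ⟨n, N.le hn.mem⟩ := by simpa using hf 1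
  have hf₁' : f' ⟨n, N.le hn.mem⟩ = ⟨m, M.le hm.mem⟩ := by simpa using hf' 1
  -- Only the orbits of `m` and `n` are matched by `f` and `f'`; the rest of `M₀` and `N₀` may
  -- differ and is compensated by summands of length zero.
  suffices Isomorphic (directSum M (lengthZero N)) (directSum N (lengthZero M)) by
    have := this.plusClass_eq
    rwa [plusClass_directSum, plusClass_directSum, plusClass_eq_zero (M := lengthZero N) rfl,
      plusClass_eq_zero (M := lengthZero M) rfl, add_zero, add_zero] at this
  -- A composite of shears, so it is bijective whatever `f` and `f'` are. It sends `(g m, 0)` to `(g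
  -- n, g m - f' (g n)) = (g n, 0)`, and its inverse has the same form with `f` and `f'` exchanged.
  let E : (M.M₀ × N.M₀) ≃ₗ[K] (N.M₀ × M.M₀) :=
    { toFun := fun x => (x.2 + f x.1, x.1 - f' (x.2 + f x.1))
      invFun := fun y => (y.2 + f' y.1, y.1 - f (y.2 + f' y.1))
      map_add' := fun x y => by
        simp only [Prod.fst_add, Prod.snd_add, map_add, Prod.mk_add_mk, Prod.mk.injEq]
        constructor <;> abel
      map_smul' := fun c x => by
        simp [smul_sub]
      left_inv := fun x => by simp
      right_inv := fun y => by simp }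
  let P : ∀ {V W : Type (max u v)} [AddCommGroup V] [Module K V] [AddCommGroup W] [Module K W]
      (A : Submodule K V) (B : Submodule K W), (A.prod B) ≃ₗ[K] (A × B) := fun A B =>
    { toFun := fun x => (⟨x.1.1, x.2.1⟩, ⟨x.1.2, x.2.2⟩)
      invFun := fun x => ⟨(x.1, x.2), x.1.2, x.2.2⟩
      map_add' := fun _ _ => rfl
      map_smul' := fun _ _ => rfl
      left_inv := fun _ => rfl
      right_inv := fun _ => rfl }
  have hspan : ∀ {M N : Glider K G} {m : M.Ω}, M.IsGeneratedBy m →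
      (directSum M (lengthZero N)).M₁ = Submodule.span K {((m, 0) : M.Ω × N.Ω)} := by
    intro M N m hm
    change M.M₁.prod ⊥ = _
    rw [hm.2]
    ext ⟨x, y⟩
    simp only [Submodule.mem_prod, Submodule.mem_span_singleton, Submodule.mem_bot, Prod.smul_mk,
      smul_zero, Prod.mk.injEq]
    exact ⟨fun ⟨⟨a, h⟩, h'⟩ => ⟨a, h, h'.symm⟩, fun ⟨a, h, h'⟩ => ⟨⟨a, h⟩, h'.symm⟩⟩
  have key : ∀ {M N : Glider K G} {m : M.Ω} {n : N.Ω} (hm : M.IsGeneratedBy m)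
      (hn : N.IsGeneratedBy n) (E : (M.M₀ × N.M₀) ≃ₗ[K] (N.M₀ × M.M₀)),
      (∀ g, E (⟨M.ρ g m, M.smul_mem g m hm.mem⟩, 0) = (⟨N.ρ g n, N.smul_mem g n hn.mem⟩, 0)) →
      IsHom (directSum M (lengthZero N)) (directSum N (lengthZero M))
        ((P M.M₀ N.M₀).trans (E.trans (P N.M₀ M.M₀).symm)).toLinearMap := by
    intro M N m n hm hn E hE
    have hE₁ : E (⟨m, M.le hm.mem⟩, 0) = (⟨n, N.le hn.mem⟩, 0) := by simpa using hE 1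
    have h₁ : ∀ h, (((P M.M₀ N.M₀).trans (E.trans (P N.M₀ M.M₀).symm)) ⟨(m, 0), h⟩ : N.Ω × M.Ω) =
        (n, 0) := fun h =>
      congrArg (fun x => ((P N.M₀ M.M₀).symm x : N.Ω × M.Ω)) hE₁
    have h₂ : ∀ g h, (((P M.M₀ N.M₀).trans (E.trans (P N.M₀ M.M₀).symm)) ⟨(M.ρ g m, 0), h⟩ :
        N.Ω × M.Ω) = (N.ρ g n, 0) := fun g h =>
      congrArg (fun x => ((P N.M₀ M.M₀).symm x : N.Ω × M.Ω)) (hE g)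
    refine IsHom.of_span _ _ (hspan hm) ?_ ?_
    · rintro _ rfl _
      exact (h₁ _).symm ▸ ⟨hn.mem, Submodule.zero_mem _⟩
    · rintro g _ rfl _
      have h₃ : (directSum N (lengthZero M)).ρ g (n, 0) = (N.ρ g n, 0) :=
        Prod.ext rfl (map_zero (M.ρ g))
      have h₄ : (directSum M (lengthZero N)).ρ g (m, 0) = (M.ρ g m, 0) :=
        Prod.ext rfl (map_zero (N.ρ g))
      refine Eq.trans ?_ ((congrArg ((directSum N (lengthZero M)).ρ g) (h₁ _)).trans h₃).symm
      refine Eq.trans ?_ (h₂ g ⟨M.smul_mem g m hm.mem, Submodule.zero_mem _⟩)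
      exact congrArg (fun x => (((P M.M₀ N.M₀).trans (E.trans (P N.M₀ M.M₀).symm)) x : N.Ω × M.Ω))
        (Subtype.ext h₄)
  have hE : ∀ g, E (⟨M.ρ g m, hM g⟩, 0) = (⟨N.ρ g n, hN g⟩, 0) := fun g => by
    simp [E, hf, hf']
  exact ⟨(P M.M₀ N.M₀).trans (E.trans (P N.M₀ M.M₀).symm), key hm hn E hE,
    key hn hm E.symm fun g => by rw [LinearEquiv.symm_apply_eq, hE]⟩

/-! ### Irreducible gliders -/

/-- For any nonzero `m ∈ M₁`, the subglider `K m ⊆ K[G] m` is nontrivial, so by irreducibility it is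
the whole glider. -/
theorem IsIrreducible.exists_generator {M : Glider K G} (h : M.IsIrreducible) :
    ∃ m, M.IsGeneratedBy m ∧ M.M₀ = Submodule.span K (Set.range fun g => M.ρ g m) := by
  obtain ⟨m, hm, hm0⟩ := Submodule.exists_mem_ne_zero_of_ne_bot h.1
  by_contra! hne
  have h₁ := h.2 (Submodule.span K (Set.range fun g => M.ρ g m)) (Submodule.span K {m})
    (Submodule.span_le.2 <| Set.singleton_subset_iff.2 <| Submodule.subset_span ⟨1, by simp⟩)
    (Submodule.span_le.2 <| by rintro _ ⟨g, rfl⟩; exact M.smul_mem g m hm)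
    (Submodule.span_le.2 <| Set.singleton_subset_iff.2 hm)
    (fun g n hn => by
      obtain ⟨c, rfl⟩ := Submodule.mem_span_singleton.1 hn
      rw [map_smul]
      exact Submodule.smul_mem _ _ (Submodule.subset_span ⟨g, rfl⟩))
    (fun h' => hne m ⟨hm0, h'.2.symm⟩ h'.1.symm)
  exact hm0 (Submodule.span_singleton_eq_bot.1 h₁)

theorem IsGeneratedBy.isIrreducible {M : Glider K G} {m : M.Ω} (h : M.IsGeneratedBy m)
    (h₀ : M.M₀ = Submodule.span K (Set.range fun g => M.ρ g m)) : M.IsIrreducible := by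
  refine ⟨fun hb => h.1 (Submodule.span_singleton_eq_bot.1 (h.2.symm.trans hb)), ?_⟩
  intro N₀ N₁ _ hN₀ hN₁ hsmul hne
  by_contra hbot
  obtain ⟨x, hx, hx0⟩ := Submodule.exists_mem_ne_zero_of_ne_bot hbot
  obtain ⟨c, rfl⟩ := Submodule.mem_span_singleton.1 (h.2 ▸ hN₁ hx)
  have hc : c ≠ 0 := fun hc => hx0 (by rw [hc, zero_smul])
  have hm : m ∈ N₁ := by simpa [hc] using N₁.smul_mem c⁻¹ hx
  refine hne ⟨le_antisymm hN₀ ?_, le_antisymm hN₁ ?_⟩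
  · rw [h₀, Submodule.span_le]
    rintro _ ⟨g, rfl⟩
    exact hsmul g m hm
  · rw [h.2, Submodule.span_singleton_le_iff_mem]
    exact hm

/-- The linear characters occurring in `K[G] m` are those which are matrix coefficients of `m`. -/
theorem mem_linearPart_iff [Finite G] [CharZero K] {M : Glider K G} {m : M.Ω}
    (h : M.IsGeneratedBy m) (h₀ : M.M₀ = Submodule.span K (Set.range fun g => M.ρ g m))
    (χ : G →* Kˣ) : χ ∈ M.linearPart ↔ charFun χ ∈ coeffSpace M.ρ m := by
  have := Fintype.ofFinite G
  have hcard : (Fintype.card G : K) ≠ 0 := Nat.cast_ne_zero.2 Fintype.card_ne_zero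
  have hχ : ∀ g, ((χ g : Kˣ) : K)⁻¹ * χ g = 1 := fun g => inv_mul_cancel₀ (χ g).ne_zero
  constructor
  · rintro ⟨v, hv, hv0, hvχ⟩
    obtain ⟨l, hl⟩ := not_forall.1 (mt (Module.forall_dual_apply_eq_zero_iff K v).1 hv0)
    -- Averaging against `χ⁻¹` gives a functional that transforms by `χ` and equals `|G| l v` at
    -- `v`. It cannot vanish at the generator `m`, and after scaling its coefficient at `m` is `χ`.
    let l' : Module.Dual K M.Ω := ∑ g, ((χ g : Kˣ) : K)⁻¹ • (l ∘ₗ M.ρ g)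
    have happ : ∀ x, l' x = ∑ g, ((χ g : Kˣ) : K)⁻¹ * l (M.ρ g x) := fun x => by
      simp [l', LinearMap.sum_apply]
    have heq : ∀ h x, l' (M.ρ h x) = χ h * l' x := fun h x => by
      rw [happ, happ, Finset.mul_sum]
      refine Fintype.sum_equiv (Equiv.mulRight h) _ _ fun g => ?_
      have hu : ((χ h : Kˣ) : K) ≠ 0 := (χ h).ne_zero
      simp only [Equiv.coe_mulRight, map_mul, Units.val_mul, Module.End.mul_apply, mul_inv]
      field_simp
    have hl'v : l' v ≠ 0 := by
      rw [happ]
      simp only [hvχ, map_smul, smul_eq_mul, ← mul_assoc, hχ, one_mul, Finset.sum_const,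
        Finset.card_univ, nsmul_eq_mul]
      exact mul_ne_zero hcard hl
    have hl'm : l' m ≠ 0 := by
      intro hzero
      have hle : M.M₀ ≤ LinearMap.ker l' := by
        rw [h₀, Submodule.span_le]
        rintro _ ⟨g, rfl⟩
        rw [SetLike.mem_coe, LinearMap.mem_ker, heq, hzero, mul_zero]
      exact hl'v (hle hv)
    refine mem_coeffSpace.2 ⟨(l' m)⁻¹ • l', fun g => ?_⟩
    rw [LinearMap.smul_apply, heq, smul_eq_mul, mul_left_comm, inv_mul_cancel₀ hl'm, mul_one]
    rfl
  · intro hmem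
    obtain ⟨l, hl⟩ := mem_coeffSpace.1 hmem
    -- Up to the factor `|G|`, this is the projection of `m` to its `χ`-isotypic component; `l`
    -- takes the value `|G| ≠ 0` on it.
    refine ⟨∑ g, ((χ g : Kˣ) : K)⁻¹ • M.ρ g m, Submodule.sum_mem _ fun g _ =>
      Submodule.smul_mem _ _ (M.smul_mem g m h.mem), fun hzero => ?_, fun k => ?_⟩
    · have h₁ := congrArg l hzero
      simp only [map_sum, map_smul, ← hl, smul_eq_mul, charFun, hχ, map_zero, Finset.sum_const,
        Finset.card_univ, nsmul_eq_mul, mul_one] at h₁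
      exact hcard h₁
    · rw [map_sum, Finset.smul_sum]
      refine Fintype.sum_equiv (Equiv.mulLeft k) _ _ fun g => ?_
      have hu : ((χ k : Kˣ) : K) ≠ 0 := (χ k).ne_zero
      simp only [Equiv.coe_mulLeft, map_mul, Units.val_mul, Module.End.mul_apply, map_smul,
        smul_smul]
      congr 1
      field_simp

/-! ### Classes of irreducible gliders and their powers -/

/-- A tensor power of an irreducible glider need not be irreducible, since its degree `0` part can
exceed what the line generates. The line in degree `-1` persists, and it alone matters for the
class. -/
theorem exists_plusClass_pow [Finite G] {M : Glider K G} {m : M.Ω} (h : M.IsGeneratedBy m)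
    (n : ℕ) : ∃ (P : Glider K G) (p : P.Ω), P.IsGeneratedBy p ∧
      coeffSpace P.ρ p = coeffSpace M.ρ m ^ n ∧ plusClass M ^ n = plusClass P := by
  induction n with
  | zero =>
    refine ⟨linear 1, _, linear_isGeneratedBy 1, ?_, ?_⟩
    · rw [coeffSpace_linear, pow_zero, Submodule.one_eq_span]
      rfl
    · rw [pow_zero]
      rfl
  | succ n ih =>
    obtain ⟨P, p, hp, hc, hP⟩ := ih
    refine ⟨tensor P M, _, hp.tensor h, ?_, ?_⟩
    · rw [pow_succ, ← hc]
      exact coeffSpace_tmul P.ρ M.ρ p m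
    · rw [pow_succ, hP, plusClass_mul]

open scoped Classical in
theorem countQ_qClass_pow [Finite G] {M : Glider K G} {m : M.Ω} (h : M.IsGeneratedBy m)
    (hM : M.IsIrreducible) (n : ℕ) (W : Submodule K (G → K)) :
    countQ W (qClass M hM ^ n) = if coeffSpace M.ρ m ^ n ≤ W then 1 else 0 := by
  obtain ⟨P, p, hp, hc, hP⟩ := exists_plusClass_pow h n
  have hval : ((redClass M hM ^ n : RBar K G) : KPlus K G) = plusClass P := by
    rw [← hP]
    rfl
  rw [qClass, Algebra.TensorProduct.tmul_pow, one_pow, countQ_tmul, hval, countPlus_plusClass,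
    hp.finrank_coeffSub, hc]
  split_ifs <;> simp

open scoped Classical in
theorem countQ_qClass [Finite G] {M : Glider K G} {m : M.Ω} (h : M.IsGeneratedBy m)
    (hM : M.IsIrreducible) (W : Submodule K (G → K)) :
    countQ W (qClass M hM) = if coeffSpace M.ρ m ≤ W then 1 else 0 := by
  simpa using countQ_qClass_pow h hM 1 W

/-- Relations between powers of classes of irreducible gliders are relations between powers of
spaces of matrix coefficients. -/
theorem qClass_pow_eq_iff [Finite G] {M N : Glider K G} {m : M.Ω} {x : N.Ω}
    (hm : M.IsGeneratedBy m) (hx : N.IsGeneratedBy x) (hM : M.IsIrreducible)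
    (hN : N.IsIrreducible) (n : ℕ) :
    qClass M hM ^ n = qClass N hN ↔ coeffSpace M.ρ m ^ n = coeffSpace N.ρ x := by
  constructor
  · intro h
    -- The indicator functions of the subspaces `W` containing each space agree; taking `W` to be
    -- either space gives both inclusions.
    have key : ∀ W, coeffSpace M.ρ m ^ n ≤ W ↔ coeffSpace N.ρ x ≤ W := fun W => by
      have := congrArg (countQ W) h
      rw [countQ_qClass_pow hm, countQ_qClass hx] at this
      split_ifs at this with h₁ h₂ h₂ <;> simp_all
    exact le_antisymm ((key _).2 le_rfl) ((key _).1 le_rfl)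
  · intro h
    obtain ⟨P, p, hp, hc, hP⟩ := exists_plusClass_pow hm n
    rw [qClass, Algebra.TensorProduct.tmul_pow, one_pow, qClass]
    congr 1
    refine Subtype.ext ?_
    change plusClass M ^ n = plusClass N
    rw [hP]
    exact plusClass_eq_of_coeffSpace_eq hp hx (hc.trans h)

/-! ### Translation-stable subspaces of functions -/

variable (K) in
/-- The functions `f` with `f (g h) = f g` for `h ∈ H`. -/
def rightInvariants (H : Subgroup G) : Subalgebra K (G → K) where
  carrier := {f | ∀ g, ∀ h ∈ H, f (g * h) = f g}
  mul_mem' ha hb g h hh := by simp [ha g h hh, hb g h hh]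
  add_mem' ha hb g h hh := by simp [ha g h hh, hb g h hh]
  algebraMap_mem' _ _ _ _ := rfl

theorem mem_rightInvariants {H : Subgroup G} {f : G → K} :
    f ∈ rightInvariants K H ↔ ∀ g, ∀ h ∈ H, f (g * h) = f g := Iff.rfl

/-- A subalgebra of the functions on a finite group which is stable under left translations consists
of the functions that are right invariant under some subgroup. -/
theorem exists_eq_rightInvariants [Finite G] (E : Subalgebra K (G → K))
    (hE : ∀ f ∈ E, ∀ h : G, (fun g => f (h * g)) ∈ E) :
    ∃ H : Subgroup G, E = rightInvariants K H := by
  classical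
  -- The points that `E` does not separate from `1`. Translation stability makes them a subgroup and
  -- makes `E` right invariant under it.
  let H : Subgroup G :=
    { carrier := {h | ∀ f ∈ E, f h = f 1}
      mul_mem' := fun {a b} ha hb f hf => by
        have := hb _ (hE f hf a)
        rw [this, mul_one, ha f hf]
      one_mem' := fun _ _ => rfl
      inv_mem' := fun {a} ha f hf => by
        have := ha _ (hE f hf a⁻¹)
        simpa using this.symm }
  have hright : E ≤ rightInvariants K H := fun f hf g h hh => by
    simpa using hh _ (hE f hf g)
  refine ⟨H, le_antisymm hright ?_⟩
  have := Fintype.ofFinite G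
  have := Fintype.ofFinite (G ⧸ H)
  have hsep : ∀ x y : G, (y : G ⧸ H) ≠ x → ∃ f ∈ E, f x = 1 ∧ f y = 0 := by
    intro x y hxy
    have hnot : x⁻¹ * y ∉ H := fun h => hxy (QuotientGroup.eq.2 h).symm
    have hnot' : ¬ ∀ f ∈ E, f (x⁻¹ * y) = f 1 := hnot
    push Not at hnot'
    obtain ⟨f, hf, hne⟩ := hnot'
    have hne' : f 1 - f (x⁻¹ * y) ≠ 0 := sub_ne_zero.2 hne.symm
    -- Translate by `x⁻¹` a function separating `x⁻¹ y` from `1`, then normalise to the values `1`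
    -- at `x` and `0` at `y`.
    refine ⟨(f 1 - f (x⁻¹ * y))⁻¹ • ((fun g => f (x⁻¹ * g)) - algebraMap K _ (f (x⁻¹ * y))),
      E.smul_mem (E.sub_mem (hE f hf _) (E.algebraMap_mem _)) _, ?_, ?_⟩
    · simp [hne']
    · simp
  choose! c hcE hcx hcy using hsep
  have hind : ∀ q : G ⧸ H, ∃ e ∈ E, ∀ z : G, e z = if (z : G ⧸ H) = q then 1 else 0 := by
    intro q
    obtain ⟨x, rfl⟩ := QuotientGroup.mk_surjective q
    -- The product of the separating functions over all `y` outside `xH` is the indicator of `xH`.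
    -- These indicators span the functions on `G/H`.
    refine ⟨∏ y ∈ Finset.univ.filter fun y : G => (y : G ⧸ H) ≠ x, c x y,
      Subalgebra.prod_mem _ fun y hy => hcE x y (Finset.mem_filter.1 hy).2, fun z => ?_⟩
    rw [Finset.prod_apply]
    split_ifs with hz
    · refine Finset.prod_eq_one fun y hy => ?_
      have hy' := (Finset.mem_filter.1 hy).2
      have := hright (hcE x y hy') x (x⁻¹ * z) (QuotientGroup.eq.1 hz.symm)
      rw [mul_inv_cancel_left] at this
      rw [this, hcx x y hy']
    · exact Finset.prod_eq_zero (Finset.mem_filter.2 ⟨Finset.mem_univ z, hz⟩) (hcy x z hz)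
  choose e heE he using hind
  intro f hf
  have hfe : f = ∑ q : G ⧸ H, f q.out • e q := by
    funext z
    obtain ⟨h, hh⟩ := QuotientGroup.mk_out_eq_mul H z
    simp [he, hh, hf z h h.2]
  rw [hfe]
  exact Subalgebra.sum_mem _ fun q _ => E.smul_mem (heE q) _

/-- A translation-stable space of functions some power of which is the constants is spanned by a
linear character. -/
theorem exists_eq_span_charFun {W : Submodule K (G → K)} (h₀ : W ≠ ⊥)
    (hW : ∀ f ∈ W, ∀ h : G, (fun g => f (h * g)) ∈ W) {n : ℕ} (hn : 1 ≤ n) (hpow : W ^ n = 1) :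
    ∃ χ : G →* Kˣ, W = Submodule.span K {charFun χ} := by
  obtain ⟨k, rfl⟩ := Nat.exists_eq_add_of_le' hn
  obtain ⟨f, hf, hf0⟩ := Submodule.exists_mem_ne_zero_of_ne_bot h₀
  -- With `n = k + 1`, the product `f ^ k * f'` lies in `W ^ n`, the constants. Taking `f' = f`
  -- shows that `f` vanishes nowhere, and then comparison makes every `f'` a multiple of `f`.
  have hconst : ∀ f' ∈ W, ∃ c : K, ∀ g, f g ^ k * f' g = c := by
    intro f' hf'
    have hmem : f ^ k * f' ∈ W ^ (k + 1) := by
      rw [pow_succ]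
      exact Submodule.mul_mem_mul (Submodule.pow_mem_pow W hf k) hf'
    rw [hpow, Submodule.mem_one] at hmem
    obtain ⟨c, hc⟩ := hmem
    exact ⟨c, fun g => (congrFun hc g).symm⟩
  obtain ⟨a, ha⟩ := hconst f hf
  obtain ⟨g₀, hg₀⟩ := Function.ne_iff.1 hf0
  have ha0 : a ≠ 0 := by
    rw [← ha g₀]
    exact mul_ne_zero (pow_ne_zero _ hg₀) hg₀
  have hspan : ∀ f' ∈ W, ∃ c : K, ∀ g, f' g = c * f g := by
    intro f' hf'
    obtain ⟨b, hb⟩ := hconst f' hf'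
    refine ⟨b / a, fun g => ?_⟩
    have hg : f g ^ k ≠ 0 := fun h => ha0 (by rw [← ha g, h, zero_mul])
    refine mul_left_cancel₀ hg ?_
    rw [hb g, mul_left_comm, ha g, div_mul_cancel₀ _ ha0]
  have hf1 : f 1 ≠ 0 := fun h => ha0 (by rw [← ha 1, h, mul_zero])
  -- The left translate of `f` by `x` lies in `W`, so it is a multiple of `f`; evaluation at `1`
  -- finds the factor `f x / f 1`.
  have hmul : ∀ x y, f (x * y) * f 1 = f x * f y := by
    intro x y
    obtain ⟨c, hc⟩ := hspan _ (hW f hf x)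
    have h₁ := hc 1
    rw [mul_one] at h₁
    rw [hc y, h₁]
    ring
  let ψ : G →* K :=
    { toFun := fun g => f g / f 1
      map_one' := div_self hf1
      map_mul' := fun x y => by
        field_simp
        exact hmul x y }
  refine ⟨ψ.toHomUnits, ?_⟩
  have hψ : charFun ψ.toHomUnits = (f 1)⁻¹ • f :=
    funext fun g => by
      change f g / f 1 = (f 1)⁻¹ * f g
      rw [div_eq_inv_mul]
  rw [hψ, Submodule.span_singleton_smul_eq (IsUnit.mk0 _ (inv_ne_zero hf1))]
  refine le_antisymm (fun f' hf' => ?_) ((Submodule.span_singleton_le_iff_mem _ _).2 hf)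
  obtain ⟨c, hc⟩ := hspan f' hf'
  exact Submodule.mem_span_singleton.2 ⟨c, funext fun g => (hc g).symm⟩

/-- A proper subgroup of a finite nilpotent group lies in the kernel of a nontrivial linear
character. -/
theorem exists_character_ne_one [IsAlgClosed K] [CharZero K] [Finite G] [Group.IsNilpotent G]
    {H : Subgroup G} (hH : H ≠ ⊤) : ∃ χ : G →* Kˣ, χ ≠ 1 ∧ ∀ h ∈ H, χ h = 1 := by
  obtain ⟨N, hN, hHN⟩ := (eq_top_or_exists_le_coatom H).resolve_left hH
  -- Entries `0` and `2` of the list are nilpotency and normality of all maximal subgroups. The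
  -- quotient `G ⧸ N` is then nontrivial and solvable, so it has a nontrivial abelianization and
  -- hence a nontrivial character.
  have hnormal : N.Normal :=
    (Group.isNilpotent_of_finite_tfae (G := G)).out 0 2 rfl rfl |>.1 inferInstance N hN
  have : Nontrivial (G ⧸ N) := QuotientGroup.nontrivial_iff.2 hN.1
  have hlt := Group.IsSolvable.commutator_lt_top_of_nontrivial (G ⧸ N)
  have : Nontrivial (Abelianization (G ⧸ N)) := QuotientGroup.nontrivial_iff.2 hlt.ne
  obtain ⟨a, ha⟩ := exists_ne (1 : Abelianization (G ⧸ N))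
  obtain ⟨φ, hφ⟩ := CommGroup.exists_apply_ne_one_of_hasEnoughRootsOfUnity
    (Abelianization (G ⧸ N)) K ha
  let π : G →* Abelianization (G ⧸ N) := Abelianization.of.comp (QuotientGroup.mk' N)
  refine ⟨φ.comp π, fun h => hφ ?_, fun h hh => ?_⟩
  · obtain ⟨y, rfl⟩ := QuotientGroup.mk_surjective a
    obtain ⟨g, rfl⟩ := QuotientGroup.mk_surjective y
    exact DFunLike.congr_fun h g
  · have : QuotientGroup.mk' N h = 1 := (QuotientGroup.eq_one_iff h).2 (hHN hh)
    rw [MonoidHom.comp_apply, MonoidHom.comp_apply, this, map_one, map_one]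

/-! ### The gliders induced from trivial representations -/

/-- The generator `1 ⊗ 1` of the glider induced from the trivial representation. -/
def inducedGen (K : Type u) [Field K] (H : Subgroup G) :
    Representation.IndV H.subtype (linear (1 : H →* Kˣ) : Glider K H).ρ :=
  Representation.IndV.mk H.subtype _ 1 (ULift.up 1)

theorem ind_inducedGen (H : Subgroup G) (g : G) :
    Representation.ind H.subtype (linear (1 : H →* Kˣ) : Glider K H).ρ g (inducedGen K H) =
      Representation.IndV.mk H.subtype _ g⁻¹ (ULift.up 1) := by
  rw [inducedGen, Representation.ind_mk, one_mul]

theorem linear_one_ρ (H : Type v) [Group H] (h : H) (x : ULift.{v} K) :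
    (linear (1 : H →* Kˣ) : Glider K H).ρ h x = x := by
  rw [linear_ρ, MonoidHom.one_apply, Units.val_one, one_smul]

/-- In the coinvariants `hg ⊗ ha` is identified with `g ⊗ a`, and `h` fixes `a`. -/
theorem indV_mk_mul (H : Subgroup G) (h : H) (g : G) (a : ULift.{v} K) :
    Representation.IndV.mk H.subtype (linear (1 : H →* Kˣ) : Glider K H).ρ (h * g) a =
      Representation.IndV.mk H.subtype (linear (1 : H →* Kˣ) : Glider K H).ρ g a := by
  have := Representation.Coinvariants.mk_self_apply
    (Representation.tprod ((Representation.leftRegular K G).comp H.subtype)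
      (linear (1 : H →* Kˣ) : Glider K H).ρ) h (MonoidAlgebra.single g 1 ⊗ₜ a)
  rw [Representation.tprod_apply, TensorProduct.map_tmul, linear_one_ρ] at this
  simpa using this

/-- The orbit of `1 ⊗ 1` is the coset basis of the permutation module on `G/H`, so its matrix
coefficients are arbitrary functions on `G/H`. -/
theorem coeffSpace_inducedGen (H : Subgroup G) :
    coeffSpace (Representation.ind H.subtype (linear (1 : H →* Kˣ) : Glider K H).ρ)
      (inducedGen K H) = Subalgebra.toSubmodule (rightInvariants K H) := by
  ext f
  rw [mem_coeffSpace, Subalgebra.mem_toSubmodule, mem_rightInvariants]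
  constructor
  · rintro ⟨l, hl⟩ g h hh
    rw [hl, hl, ind_inducedGen, ind_inducedGen, mul_inv_rev]
    exact congrArg l (indV_mk_mul H ⟨h⁻¹, H.inv_mem hh⟩ g⁻¹ _)
  · intro hf
    -- The functional `g ⊗ a ↦ f (g⁻¹) a`; the inverse occurs because `g` moves `1 ⊗ 1` to `g⁻¹ ⊗ 1`
    -- in this model. Right `H`-invariance of `f` makes it descend to the coinvariants.
    let B : MonoidAlgebra K G →ₗ[K] ULift.{v} K →ₗ[K] K :=
      (Finsupp.linearCombination K fun g => f g⁻¹ • (down K).toLinearMap) ∘ₗ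
        (MonoidAlgebra.coeffLinearEquiv K).toLinearMap
    have hB : ∀ g a, B (MonoidAlgebra.single g 1) a = f g⁻¹ * down K a := fun g a => by
      simp [B]
    let l := Representation.Coinvariants.lift
      (Representation.tprod ((Representation.leftRegular K G).comp H.subtype)
        (linear (1 : H →* Kˣ) : Glider K H).ρ) (TensorProduct.lift B) (by
        intro h
        refine TensorProduct.ext (MonoidAlgebra.lhom_ext' fun g => LinearMap.ext_ring ?_)
        ext a
        have hfh : f (g⁻¹ * (h : G)⁻¹) = f g⁻¹ := hf _ _ (H.inv_mem h.2)
        simp [hB, hfh])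
    refine ⟨l, fun g => ?_⟩
    rw [ind_inducedGen]
    change f g = B (MonoidAlgebra.single g⁻¹ 1) (ULift.up 1)
    rw [hB, inv_inv]
    exact (mul_one _).symm

theorem inducedGen_ne_zero (H : Subgroup G) : inducedGen K H ≠ 0 := by
  intro h
  have h₁ := coeffSpace_inducedGen (K := K) H
  rw [h, coeffSpace_zero] at h₁
  have h₂ : (1 : G → K) ∈ (⊥ : Submodule K (G → K)) := h₁ ▸ (rightInvariants K H).one_mem
  exact one_ne_zero (α := K) (congrFun ((Submodule.mem_bot K).1 h₂) 1)

/-! ### Linear characters among the functions on `G/H` -/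

theorem charFun_mem_rightInvariants {H : Subgroup G} {χ : G →* Kˣ} :
    charFun χ ∈ rightInvariants K H ↔ ∀ h ∈ H, χ h = 1 := by
  rw [mem_rightInvariants]
  constructor
  · intro h k hk
    have := h 1 k hk
    rw [one_mul] at this
    refine Units.ext (this.trans ?_)
    simp [charFun]
  · intro h g k hk
    simp [charFun, h k hk]

/-- The indicator of `H` is invariant, nonzero at `1` and zero off `H`, whereas a nonzero multiple
of a character vanishes nowhere. -/
theorem rightInvariants_not_le_span {H : Subgroup G} (hH : H ≠ ⊤) (χ : G →* Kˣ) :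
    ¬ Subalgebra.toSubmodule (rightInvariants K H) ≤ Submodule.span K {charFun χ} := by
  classical
  intro hle
  obtain ⟨x, hx⟩ := SetLike.exists_not_mem_of_ne_top H hH
  have hmem : (fun g => if g ∈ H then (1 : K) else 0) ∈ rightInvariants K H := by
    intro g h hh
    simp [H.mul_mem_cancel_right hh]
  obtain ⟨c, hc⟩ := Submodule.mem_span_singleton.1 (hle hmem)
  have h₁ := congrFun hc 1
  have h₂ := congrFun hc x
  simp [charFun] at h₁
  simp [charFun, hx, h₁] at h₂

/-- The kernel of `χ` is normal and contains `H`; it is not `H`, so maximality makes it all of `G`.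
-/
theorem eq_one_of_isCoatom {H : Subgroup G} (hH : IsCoatom H) (hn : ¬ H.Normal) {χ : G →* Kˣ}
    (hχ : ∀ h ∈ H, χ h = 1) : χ = 1 := by
  have hle : H ≤ χ.ker := fun h hh => hχ h hh
  rcases hle.eq_or_lt with h | h
  · exact absurd (h ▸ MonoidHom.normal_ker χ) hn
  · exact MonoidHom.ker_eq_top_iff.1 (hH.2 _ h)

section Finite

variable [Finite G]

theorem induced_isGeneratedBy (H : Subgroup G) :
    (induced H (linear (1 : H →* Kˣ) : Glider K H)).IsGeneratedBy (inducedGen K H) := by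
  refine ⟨inducedGen_ne_zero H, ?_⟩
  change Submodule.map _ (linear (1 : H →* Kˣ) : Glider K H).M₁ = _
  rw [(linear_isGeneratedBy (1 : H →* Kˣ)).2, Submodule.map_span, Set.image_singleton]
  rfl

theorem induced_M₀ (H : Subgroup G) :
    (induced H (linear (1 : H →* Kˣ) : Glider K H)).M₀ = Submodule.span K (Set.range fun g =>
      (induced H (linear (1 : H →* Kˣ) : Glider K H)).ρ g (inducedGen K H)) := by
  have h : ∀ g, Submodule.map (Representation.IndV.mk H.subtype _ g)
      (linear (1 : H →* Kˣ) : Glider K H).M₀ =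
        Submodule.span K {Representation.IndV.mk H.subtype
          (linear (1 : H →* Kˣ) : Glider K H).ρ g (ULift.up 1)} := fun g => by
    change Submodule.map _ (linear (1 : H →* Kˣ) : Glider K H).M₁ = _
    rw [(linear_isGeneratedBy (1 : H →* Kˣ)).2, Submodule.map_span, Set.image_singleton]
  apply le_antisymm
  · refine iSup_le fun g => ?_
    rw [h, Submodule.span_singleton_le_iff_mem]
    refine Submodule.subset_span ⟨g⁻¹, ?_⟩
    change Representation.ind H.subtype _ _ _ = _
    rw [ind_inducedGen, inv_inv]
  · rw [Submodule.span_le]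
    rintro _ ⟨g, rfl⟩
    change Representation.ind H.subtype _ _ _ ∈ _
    rw [ind_inducedGen]
    refine Submodule.mem_iSup_of_mem g⁻¹ ?_
    rw [h]
    exact Submodule.mem_span_singleton_self _

theorem induced_isIrreducible (H : Subgroup G) :
    (induced H (linear (1 : H →* Kˣ) : Glider K H)).IsIrreducible :=
  (induced_isGeneratedBy H).isIrreducible (induced_M₀ H)

theorem linearPart_induced [CharZero K] (H : Subgroup G) :
    (induced H (linear (1 : H →* Kˣ) : Glider K H)).linearPart =
      {χ : G →* Kˣ | ∀ h ∈ H, χ h = 1} := by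
  ext χ
  rw [mem_linearPart_iff (induced_isGeneratedBy H) (induced_M₀ H),
    show coeffSpace (induced H (linear (1 : H →* Kˣ) : Glider K H)).ρ (inducedGen K H) = _ from
      coeffSpace_inducedGen H]
  exact charFun_mem_rightInvariants

/-! ### The obstruction module -/

end Finite

/-- The image does not depend on the chosen identification `τ`. -/
theorem range_groupAlgebraMap (τ : Abelianization G ≃* (G →* Kˣ)) :
    LinearMap.range (groupAlgebraMap τ).toLinearMap =
      Submodule.span ℚ (Set.range (linearHom (K := K) (G := G))) := by
  have happ : ∀ z, groupAlgebraMap τ (MonoidAlgebra.single z 1) = linearHom (τ z) := fun z => by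
    simp [groupAlgebraMap]
  apply le_antisymm
  · rintro _ ⟨x, rfl⟩
    change groupAlgebraMap τ x ∈ _
    induction x using MonoidAlgebra.induction_on with
    | of z =>
      rw [MonoidAlgebra.of_apply, happ]
      exact Submodule.subset_span ⟨_, rfl⟩
    | add x y hx hy => rw [map_add]; exact Submodule.add_mem _ hx hy
    | smul r x hx => rw [map_smul]; exact Submodule.smul_mem _ r hx
  · rw [Submodule.span_le]
    rintro _ ⟨χ, rfl⟩
    refine ⟨MonoidAlgebra.single (τ.symm χ) 1, ?_⟩
    change groupAlgebraMap τ _ = _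
    rw [happ, MulEquiv.apply_symm_apply]

theorem charFun_injective : Function.Injective (charFun : (G →* Kˣ) → G → K) :=
  fun _ _ h => MonoidHom.ext fun g => Units.ext (congrFun h g)

theorem span_charFun_le_iff {χ ψ : G →* Kˣ} :
    Submodule.span K {charFun χ} ≤ Submodule.span K {charFun ψ} ↔ χ = ψ := by
  refine ⟨fun h => ?_, fun h => h ▸ le_rfl⟩
  rw [Submodule.span_singleton_le_iff_mem, Submodule.mem_span_singleton] at h
  obtain ⟨c, hc⟩ := h
  have hc1 : c = 1 := by simpa [charFun] using congrFun hc 1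
  rw [hc1, one_smul] at hc
  exact charFun_injective hc.symm

variable [Finite G]

/-- The class of an irreducible glider which is not one-dimensional is not in the span of the classes
of the one-dimensional ones. -/
theorem qClass_notMem_span_linearHom [Finite (G →* Kˣ)] {M : Glider K G} {m : M.Ω}
    (h : M.IsGeneratedBy m) (hM : M.IsIrreducible)
    (hW : ∀ χ : G →* Kˣ, ¬ coeffSpace M.ρ m ≤ Submodule.span K {charFun χ}) :
    qClass M hM ∉ Submodule.span ℚ (Set.range (linearHom (K := K) (G := G))) := by
  classical
  have := Fintype.ofFinite (G →* Kˣ)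
  -- On `[K ⊆ T_ψ]` the total count is `1` and exactly the term `χ = ψ` cancels it. On a glider
  -- whose coefficients lie in no line `K χ`, only the total count survives and the value is `1`.
  let Ψ : QAlg K G →ₗ[ℚ] ℚ :=
    countQ ⊤ - ∑ χ : G →* Kˣ, countQ (Submodule.span K {charFun χ})
  have hΨ : Submodule.span ℚ (Set.range (linearHom (K := K) (G := G))) ≤ LinearMap.ker Ψ := by
    rw [Submodule.span_le]
    rintro _ ⟨ψ, rfl⟩
    change Ψ (qClass (linear ψ) (linear_isIrreducible ψ)) = 0
    have hcount : ∀ χ : G →* Kˣ, countQ (Submodule.span K {charFun χ})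
        (qClass (linear ψ) (linear_isIrreducible ψ)) = if ψ = χ then 1 else 0 := fun χ => by
      rw [countQ_qClass (linear_isGeneratedBy ψ), coeffSpace_linear]
      simp only [span_charFun_le_iff]
    rw [LinearMap.sub_apply, LinearMap.sum_apply, countQ_qClass (linear_isGeneratedBy ψ),
      if_pos le_top]
    simp only [hcount, Finset.sum_ite_eq, Finset.mem_univ, if_true, sub_self]
  intro hmem
  have h₁ : Ψ (qClass M hM) = 0 := hΨ hmem
  simp [Ψ, LinearMap.sum_apply, countQ_qClass h, hW] at h₁

/-- A character has finite order, so a power of its class is the unit `[K ⊆ T_G]`. -/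
theorem linearHom_mem_obstructionR (χ : G →* Kˣ) [Finite (G →* Kˣ)] [CharZero K] :
    linearHom χ ∈ obstructionR K G := by
  refine Submodule.subset_span ⟨linear χ, linear_isIrreducible χ, rfl, linear 1,
    linear_isIrreducible 1, (linear (1 : G →* Kˣ) : Glider K G).nonlinearPart,
    ⟨linear_isIrreducible 1, ?_, rfl⟩, ?_, orderOf χ, orderOf_pos χ, ?_⟩
  · ext ψ
    have h₀ : (linear (1 : G →* Kˣ) : Glider K G).M₀ = Submodule.span K (Set.range fun g =>
        (linear (1 : G →* Kˣ) : Glider K G).ρ g (ULift.up 1)) := by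
      refine le_antisymm ?_ le_top
      change (linear (1 : G →* Kˣ) : Glider K G).M₁ ≤ _
      rw [(linear_isGeneratedBy (1 : G →* Kˣ)).2, Submodule.span_singleton_le_iff_mem]
      exact Submodule.subset_span ⟨1, LinearMap.congr_fun (map_one (linear (1 : G →* Kˣ)).ρ) _⟩
    rw [mem_linearPart_iff (linear_isGeneratedBy 1) h₀, coeffSpace_linear,
      ← Submodule.span_singleton_le_iff_mem, span_charFun_le_iff]
    rfl
  · exact (map_mul linearHom 1 1).symm.trans (congrArg linearHom (mul_one (1 : G →* Kˣ)))
  · exact (map_pow linearHom χ _).symm.trans (congrArg linearHom (pow_orderOf_eq_one χ))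

/-- The functions on `G/H` form a subalgebra, so the class is itself idempotent and the exponent `1`
serves. -/
theorem qClass_induced_mem_obstructionR [CharZero K] {H : Subgroup G}
    (hH : (induced H (linear (1 : H →* Kˣ) : Glider K H)).linearPart = {1}) :
    qClass _ (induced_isIrreducible (K := K) H) ∈ obstructionR K G := by
  refine Submodule.subset_span ⟨_, _, rfl, _, induced_isIrreducible H, _,
    ⟨induced_isIrreducible H, hH, rfl⟩, ?_, 1, le_rfl, pow_one _⟩
  rw [← pow_two, qClass_pow_eq_iff (induced_isGeneratedBy H) (induced_isGeneratedBy H),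
    show coeffSpace (induced H (linear (1 : H →* Kˣ) : Glider K H)).ρ (inducedGen K H) = _ from
      coeffSpace_inducedGen H, pow_two]
  exact (Subalgebra.isIdempotentElem_toSubmodule _).eq

/-- For a nilpotent group the obstruction module is spanned by the one-dimensional gliders. -/
theorem obstructionR_le_of_isNilpotent [IsAlgClosed K] [CharZero K] [Group.IsNilpotent G] :
    obstructionR K G ≤ Submodule.span ℚ (Set.range (linearHom (K := K) (G := G))) := by
  refine Submodule.span_le.2 ?_
  rintro _ ⟨M, hM, rfl, N, hN, D, ⟨-, hA, -⟩, hidem, n, hn, hpow⟩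
  obtain ⟨m, hm, -⟩ := hM.exists_generator
  obtain ⟨x, hx, hx₀⟩ := hN.exists_generator
  rw [qClass_pow_eq_iff hm hx] at hpow
  rw [← pow_two, qClass_pow_eq_iff hx hx, pow_two] at hidem
  have hchar : ∀ χ, charFun χ ∈ coeffSpace N.ρ x ↔ χ = 1 := fun χ => by
    rw [← mem_linearPart_iff hx hx₀, hA, Set.mem_singleton_iff]
  have hone : (1 : G → K) ∈ coeffSpace N.ρ x := (hchar 1).2 rfl
  -- Since `T_G` occurs, the space contains the constants; idempotence closes it under products.
  let E : Subalgebra K (G → K) := (coeffSpace N.ρ x).toSubalgebra hone fun a b ha hb =>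
    hidem ▸ Submodule.mul_mem_mul ha hb
  obtain ⟨H, hEH⟩ := exists_eq_rightInvariants E fun f hf h => coeffSpace_translate hf h
  -- A nontrivial character killing a proper `H` would lie in `E`, hence in the parameter `A =
  -- {T_G}`.
  have hH : H = ⊤ := by
    by_contra hne
    obtain ⟨χ, hχ, hχH⟩ := exists_character_ne_one (K := K) hne
    have : charFun χ ∈ E := hEH ▸ charFun_mem_rightInvariants.2 hχH
    exact hχ ((hchar χ).1 this)
  have hcoeff : coeffSpace N.ρ x = 1 := by
    apply le_antisymm
    · intro f hf
      have hf' : f ∈ rightInvariants K H := hEH ▸ (show f ∈ E from hf)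
      refine Submodule.mem_one.2 ⟨f 1, funext fun g => ?_⟩
      have := hf' 1 g (hH ▸ Subgroup.mem_top g)
      rw [one_mul] at this
      exact this.symm
    · exact Submodule.one_le.2 hone
  obtain ⟨χ, hχ⟩ := exists_eq_span_charFun (coeffSpace_ne_bot hm.1)
    (fun f hf h => coeffSpace_translate hf h) hn (hpow.trans hcoeff)
  refine Submodule.subset_span ⟨χ, ?_⟩
  change qClass (linear χ) (linear_isIrreducible χ) = qClass M hM
  rw [← pow_one (qClass (linear χ) _), qClass_pow_eq_iff (linear_isGeneratedBy χ) hm, pow_one,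
    coeffSpace_linear, hχ]

end

end Glider

/-! ### The theorem -/

theorem theoremR {K : Type u} [Field K] [IsAlgClosed K] [CharZero K] {G : Type v} [Group G]
    [Finite G] (τ : Abelianization G ≃* (G →* Kˣ)) :
    (Group.IsNilpotent G ↔
      Glider.obstructionR K G = LinearMap.range (Glider.groupAlgebraMap τ).toLinearMap) ∧
    (¬ Group.IsNilpotent G → ∀ H : Subgroup G, IsCoatom H → ¬ H.Normal →
      ∃ (h : (Glider.induced H (Glider.linear (1 : H →* Kˣ))).IsIrreducible)
        (D : ∀ U : Glider.NonlinearIrrep K G, Submodule K U.V),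
        Glider.IsParam (Glider.induced H (Glider.linear (1 : H →* Kˣ))) {1} D ∧
        Glider.qClass _ h ∈ Glider.obstructionR K G ∧
        Glider.qClass _ h ∉ LinearMap.range (Glider.groupAlgebraMap τ).toLinearMap) := by
  -- The separating functional sums over all linear characters, so their number has to be finite.
  have : Finite (G →* Kˣ) := Finite.of_equiv _ τ.toEquiv
  have hind : ∀ H : Subgroup G, IsCoatom H → ¬ H.Normal →
      ∃ (h : (Glider.induced H (Glider.linear (1 : H →* Kˣ))).IsIrreducible)
        (D : ∀ U : Glider.NonlinearIrrep K G, Submodule K U.V),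
        Glider.IsParam (Glider.induced H (Glider.linear (1 : H →* Kˣ))) {1} D ∧
        Glider.qClass _ h ∈ Glider.obstructionR K G ∧
        Glider.qClass _ h ∉ LinearMap.range (Glider.groupAlgebraMap τ).toLinearMap := by
    intro H hH hn
    have hlin : (Glider.induced H (Glider.linear (1 : H →* Kˣ))).linearPart = {1} := by
      rw [Glider.linearPart_induced]
      ext χ
      refine ⟨fun hχ => Glider.eq_one_of_isCoatom hH hn hχ, ?_⟩
      rintro rfl h _
      rfl
    refine ⟨Glider.induced_isIrreducible H, _, ⟨Glider.induced_isIrreducible H, hlin, rfl⟩,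
      Glider.qClass_induced_mem_obstructionR hlin, ?_⟩
    rw [Glider.range_groupAlgebraMap]
    refine Glider.qClass_notMem_span_linearHom (Glider.induced_isGeneratedBy H) _ fun χ => ?_
    rw [show Glider.coeffSpace (Glider.induced H (Glider.linear (1 : H →* Kˣ))).ρ
      (Glider.inducedGen K H) = _ from Glider.coeffSpace_inducedGen H]
    exact Glider.rightInvariants_not_le_span hH.1 χ
  refine ⟨⟨fun h => le_antisymm ?_ ?_, fun h => ?_⟩, fun _ => hind⟩
  · rw [Glider.range_groupAlgebraMap]
    exact Glider.obstructionR_le_of_isNilpotent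
  · rw [Glider.range_groupAlgebraMap, Submodule.span_le]
    rintro _ ⟨χ, rfl⟩
    exact Glider.linearHom_mem_obstructionR χ
  -- By the same criterion it is enough that every maximal subgroup is normal; a non-normal one
  -- would give an element of `R` outside the group algebra.
  · refine ((Group.isNilpotent_of_finite_tfae (G := G)).out 0 2 rfl rfl).2 fun H hH => ?_
    by_contra hn
    obtain ⟨_, _, _, hmem, hnot⟩ := hind H hH hn
    exact hnot (h ▸ hmem)
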